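/- Let $n\ge 0$, let $D>0$ (input delay) and $\tau_d>0$ (dwell time) be arbitrary, let $P=P^{T}>0$ and $Q=Q^{T}>0$ be real $n\times n$ matrices, and let $M_A,M_B,M_K$ be real numbers. Let $|\cdot|$ denote the Euclidean norm of vectors and the induced norm of matrices. There is $\epsilon^*>0$, depending only on $n,D,\tau_d,P,Q,M_A,M_B,M_K$, such that the following holds. Let $l\ge 0$ and, for $i=0,\dots,l$, let $A_i\in\mathbb R^{n\times n}$, $B_i\in\mathbb R^{n\times 1}$, $K_i\in\mathbb R^{1\times n}$ satisfy $|A_i|\le M_A$, $|B_i|\le M_B$, $|K_i|\le M_K$, $$(A_i+B_iK_i)^{T}P+P(A_i+B_iK_i)\le -Q ,$$ and $$\epsilon:=\max_{i,j=0,\dots,l}\{|A_i-A_j|,\,|B_i-B_j|,\,|K_i-K_j|\}<\epsilon^* .$$ Then there are constants $\rho,\xi>0$ such that for every right-continuous piecewise constant switching signal $\sigma:[0,\infty)\to\{0,\dots,l\}$ whose distinct switching times are at least $\tau_d$ apart, for all $X_0\in\mathbb R^n$ and $U_0\in L^2[-D,0]$, every solution $(X,U)$ of the closed-loop system $$\dot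 X(t)=A_{\sigma(t)}X(t)+B_{\sigma(t)}U(t-D),\qquad U(t)=\frac1{l+1}\sum_{i=0}^{l}K_i\hat P_i(t),\qquad t\ge 0,$$ $$\hat P_i(t)=e^{A_iD}X(t)+\int_{t-D}^{t}e^{A_i(t-\theta)}B_iU(\theta)\,d\theta ,$$ with $X(0)=X_0$ and $U=U_0$ almost everywhere on $[-D,0)$, satisfies $$|X(t)|+\sqrt{\int_{t-D}^{t}U(\theta)^2\,d\theta}\;\le\;\rho\left(|X_0|+\sqrt{\int_{-D}^{0}U_0(\theta)^2\,d\theta}\right)e^{-\xi t},\qquad t\ge 0 .$$ Here a solution is a pair with $X$ continuous on $[0,\infty)$, $U$ square integrable on $[-D,T]$ for every $T\ge0$, the differential equation holding in the integrated (Carathéodory) sense, and the formula for $U(t)$ holding for every $t\ge0$. -/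

import Mathlib

open Filter Topology MeasureTheory
open scoped Matrix Matrix.Norms.L2Operator

namespace SwitchedDelay

noncomputable section

/-- `t > 0` is a switching time of `σ` if `σ` jumps at `t`, that is, if `σ` is not constantly
equal to `σ t` on any interval `(t - δ, t]`. -/
def IsSwitchingTime {l : ℕ} (σ : ℝ → Fin (l + 1)) (t : ℝ) : Prop :=
  0 < t ∧ ¬ ∀ᶠ s in 𝓝[<] t, σ s = σ t

/-- Right-continuous piecewise constant switching signals on `[0, ∞)` with values in
`{0, …, l}` and dwell time `τ`: two distinct switching times are at least `τ` apart.
(For `τ > 0` the switching times are therefore locally finite, and `σ` is constant between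
consecutive ones.) The values of `σ` at negative times play no role. -/
structure IsSwitchingSignal {l : ℕ} (τ : ℝ) (σ : ℝ → Fin (l + 1)) : Prop where
  right_continuous : ∀ t, 0 ≤ t → ∀ᶠ s in 𝓝[>] t, σ s = σ t
  dwell : ∀ s t, IsSwitchingTime σ s → IsSwitchingTime σ t → s < t → τ ≤ t - s

/-- The exact predictor of the single mode `(A, B)` with input delay `D`:
`e^{A D} X(t) + ∫_{t-D}^t e^{A (t-θ)} B U(θ) dθ`. -/
def predictor {n : ℕ} (D : ℝ) (A : Matrix (Fin n) (Fin n) ℝ) (B : Matrix (Fin n) (Fin 1) ℝ)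
    (X : ℝ → Fin n → ℝ) (U : ℝ → ℝ) (t : ℝ) : Fin n → ℝ :=
  NormedSpace.exp (D • A) *ᵥ X t
    + ∫ θ in (t - D)..t, NormedSpace.exp ((t - θ) • A) *ᵥ (B *ᵥ ![U θ])

/-- The average `(1/(l+1)) ∑ i, K_i P̂_i(t)` of the predictor-feedback laws of the modes. -/
def averagedFeedback {n l : ℕ} (D : ℝ) (A : Fin (l + 1) → Matrix (Fin n) (Fin n) ℝ)
    (B : Fin (l + 1) → Matrix (Fin n) (Fin 1) ℝ) (K : Fin (l + 1) → Matrix (Fin 1) (Fin n) ℝ)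
    (X : ℝ → Fin n → ℝ) (U : ℝ → ℝ) (t : ℝ) : ℝ :=
  ∑ i, (K i *ᵥ predictor D (A i) (B i) X U t) 0 / ((l : ℝ) + 1)

/-- `(X, U)` is a (Carathéodory) solution of the closed loop
`X'(t) = A_{σ(t)} X(t) + B_{σ(t)} U(t - D)`, `U(t) = (1/(l+1)) ∑ i, K_i P̂_i(t)`, `t ≥ 0`, with
initial state `X₀` and initial input history `U₀` on `[-D, 0)`. The input is locally square
integrable and the state is continuous. As `U₀` is only an `L²` function, the differential
equation holds in integrated form, i.e. `X` is locally absolutely continuous and the equation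
holds for almost every `t`. Only `X` on `[0, ∞)` and `U` on `[-D, ∞)` matter. -/
structure IsClosedLoopSolution {n l : ℕ} (D : ℝ) (A : Fin (l + 1) → Matrix (Fin n) (Fin n) ℝ)
    (B : Fin (l + 1) → Matrix (Fin n) (Fin 1) ℝ) (K : Fin (l + 1) → Matrix (Fin 1) (Fin n) ℝ)
    (σ : ℝ → Fin (l + 1)) (X₀ : Fin n → ℝ) (U₀ : ℝ → ℝ)
    (X : ℝ → Fin n → ℝ) (U : ℝ → ℝ) : Prop where
  state_continuous : ContinuousOn X (Set.Ici 0)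
  input_memLp : ∀ T, 0 ≤ T → MemLp U 2 (volume.restrict (Set.Icc (-D) T))
  initial_state : X 0 = X₀
  initial_input : ∀ᵐ θ ∂volume.restrict (Set.Ico (-D) 0), U θ = U₀ θ
  dynamics : ∀ t, 0 ≤ t →
    X t = X 0 + ∫ s in (0 : ℝ)..t, (A (σ s) *ᵥ X s + B (σ s) *ᵥ ![U (s - D)])
  feedback : ∀ t, 0 ≤ t → U t = averagedFeedback D A B K X U t

/-- The mismatch `ε = max_{i,j} {|A_i - A_j|, |B_i - B_j|, |K_i - K_j|}`, where `|·|` is the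
matrix norm induced by the Euclidean norms. -/
def mismatch {n l : ℕ} (A : Fin (l + 1) → Matrix (Fin n) (Fin n) ℝ)
    (B : Fin (l + 1) → Matrix (Fin n) (Fin 1) ℝ)
    (K : Fin (l + 1) → Matrix (Fin 1) (Fin n) ℝ) : ℝ :=
  ⨆ p : Fin (l + 1) × Fin (l + 1),
    max ‖A p.1 - A p.2‖ (max ‖B p.1 - B p.2‖ ‖K p.1 - K p.2‖)

/-- The Euclidean norm of the state plus the `L²` norm of the input over `[t - D, t]`. -/
def stateNorm {n : ℕ} (D : ℝ) (X : ℝ → Fin n → ℝ) (U : ℝ → ℝ) (t : ℝ) : ℝ :=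
  ‖WithLp.toLp 2 (X t)‖ + √(∫ θ in (t - D)..t, U θ ^ 2)

end

end SwitchedDelay

/-!
The predictor `p(t) = e^{A D} X(t) + ∫_{t-D}^t e^{A (t-θ)} B U(θ) dθ` of one fixed mode `(A, B)`,
fed with the true state of the switched system, satisfies a delay-free equation
`p' = (A + B K) p + O(ε) (|p| + ‖U‖_{L²[t-D,t]} + |U(t - D)|)`: the predictors of the other modes,
the feedback built from them and the active dynamics all differ from those of the fixed mode by
`O(ε)`. With a small weight `a > 0`, the functional
`⟪p, P p⟫ + a ∫_{t-D}^t e^{θ-t} |U(θ)|² dθ` controls `X` and `U`, and its derivative contains the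
negative terms `-|p|²`, `-‖U‖²_{L²[t-D,t]}` and `-|U(t - D)|²`, which absorb the perturbation when
`ε` is small. It does not jump, since the same mode serves as reference at every instant.
-/

namespace SwitchedDelay

section IntegralDeriv

variable {E F G : Type*} [NormedAddCommGroup E] [NormedSpace ℝ E]
  [NormedAddCommGroup F] [NormedSpace ℝ F] [NormedAddCommGroup G] [NormedSpace ℝ G]

theorem setIntegral_Ioc_indicator_Iic {h : ℝ → E} {a b s : ℝ} (has : a ≤ s) (hsb : s ≤ b) :
    ∫ r in Set.Ioc a b, (Set.Iic s).indicator h r = ∫ r in a..s, h r := by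
  rw [integral_indicator measurableSet_Iic, Measure.restrict_restrict measurableSet_Iic,
    Set.Iic_inter_Ioc_of_le hsb, intervalIntegral.integral_of_le has]

theorem setIntegral_Ioc_indicator_Ici {h : ℝ → E} {a b r : ℝ} (har : a < r) (hrb : r ≤ b) :
    ∫ s in Set.Ioc a b, (Set.Ici r).indicator h s = ∫ s in r..b, h s := by
  have hinter : Set.Ici r ∩ Set.Ioc a b = Set.Icc r b := by
    ext x
    simp only [Set.mem_inter_iff, Set.mem_Ici, Set.mem_Ioc, Set.mem_Icc]
    exact ⟨fun h => ⟨h.1, h.2.2⟩, fun h => ⟨h.1, har.trans_le h.1, h.2⟩⟩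
  rw [integral_indicator measurableSet_Ici, Measure.restrict_restrict measurableSet_Ici, hinter,
    integral_Icc_eq_integral_Ioc, intervalIntegral.integral_of_le hrb]

theorem integral_triangle_swap {h : ℝ → ℝ → E} {a b : ℝ} (hab : a ≤ b)
    (hh : Integrable (Function.uncurry h)
      ((volume.restrict (Set.Ioc a b)).prod (volume.restrict (Set.Ioc a b)))) :
    ∫ s in a..b, ∫ r in a..s, h s r = ∫ r in a..b, ∫ s in r..b, h s r := by
  let T : Set (ℝ × ℝ) := {z | z.2 ≤ z.1}
  have hT : MeasurableSet T := measurableSet_le measurable_snd measurable_fst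
  have hswap := integral_integral_swap (f := fun s r => T.indicator (Function.uncurry h) (s, r))
    (hh.indicator hT)
  rw [intervalIntegral.integral_of_le hab, intervalIntegral.integral_of_le hab]
  convert hswap using 1
  · refine setIntegral_congr_fun measurableSet_Ioc fun s hs => ?_
    exact (setIntegral_Ioc_indicator_Iic hs.1.le hs.2).symm
  · refine setIntegral_congr_fun measurableSet_Ioc fun r hr => ?_
    exact (setIntegral_Ioc_indicator_Ici hr.1 hr.2).symm

theorem integral_bilin_triangle_swap [CompleteSpace E] [CompleteSpace F] [CompleteSpace G]
    (L : E →L[ℝ] F →L[ℝ] G) {f : ℝ → E} {g : ℝ → F} {a b : ℝ} (hab : a ≤ b)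
    (hf : IntervalIntegrable f volume a b) (hg : IntervalIntegrable g volume a b) :
    ∫ s in a..b, L (f s) (∫ r in a..s, g r) = ∫ r in a..b, L (∫ s in r..b, f s) (g r) := by
  have hprod : Integrable (Function.uncurry fun s r => L (f s) (g r))
      ((volume.restrict (Set.Ioc a b)).prod (volume.restrict (Set.Ioc a b))) :=
    hf.1.op_fst_snd (op := fun x y => L x y) L.continuous₂
      ⟨‖L‖₊, fun x y => by exact_mod_cast L.le_opNorm₂ x y⟩ hg.1
  have hleft : ∫ s in a..b, L (f s) (∫ r in a..s, g r) = ∫ s in a..b, ∫ r in a..s, L (f s) (g r) :=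
    intervalIntegral.integral_congr fun s hs => by
      have hgs : IntervalIntegrable g volume a s :=
        hg.mono_set (Set.uIcc_subset_uIcc_left hs)
      exact ((L (f s)).intervalIntegral_comp_comm hgs).symm
  have hright : ∫ r in a..b, L (∫ s in r..b, f s) (g r) = ∫ r in a..b, ∫ s in r..b, L (f s) (g r) :=
    intervalIntegral.integral_congr fun r hr => by
      have hfr : IntervalIntegrable f volume r b :=
        hf.mono_set (Set.uIcc_subset_uIcc_right hr)
      exact ((L.flip (g r)).intervalIntegral_comp_comm hfr).symm
  rw [hleft, hright, integral_triangle_swap hab hprod]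

theorem intervalIntegrable_bilin (L : E →L[ℝ] F →L[ℝ] G) {f : ℝ → E} {g : ℝ → F} {a b : ℝ}
    (hf : ContinuousOn f (Set.uIcc a b)) (hg : IntervalIntegrable g volume a b) :
    IntervalIntegrable (fun s => L (f s) (g s)) volume a b := by
  obtain ⟨C, hC⟩ := isCompact_uIcc.exists_bound_of_continuousOn hf
  rw [intervalIntegrable_iff] at hg ⊢
  exact L.integrable_of_bilin_of_bdd_left C
    ((hf.mono Set.uIoc_subset_uIcc).aestronglyMeasurable measurableSet_uIoc)
    ((ae_restrict_iff' measurableSet_uIoc).2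
      (ae_of_all _ fun s hs => hC s (Set.uIoc_subset_uIcc hs))) hg

/-- `f` is, on `[0, ∞)`, a primitive of the locally integrable function `f'`; equivalently, `f` is
locally absolutely continuous with derivative `f'` almost everywhere. -/
structure HasIntegralDeriv (f f' : ℝ → E) : Prop where
  intervalIntegrable : ∀ t, 0 ≤ t → IntervalIntegrable f' volume 0 t
  eq_add_integral : ∀ t, 0 ≤ t → f t = f 0 + ∫ s in (0 : ℝ)..t, f' s

namespace HasIntegralDeriv

variable {f f' : ℝ → E} {g g' : ℝ → F}

theorem sub_eq_integral (hf : HasIntegralDeriv f f') {s t : ℝ} (hs : 0 ≤ s) (ht : 0 ≤ t) :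
    f t - f s = ∫ r in s..t, f' r := by
  rw [hf.eq_add_integral t ht, hf.eq_add_integral s hs,
    ← intervalIntegral.integral_interval_sub_left (hf.intervalIntegrable t ht)
      (hf.intervalIntegrable s hs)]
  abel

theorem continuousOn_uIcc (hf : HasIntegralDeriv f f') {t : ℝ} (ht : 0 ≤ t) :
    ContinuousOn f (Set.uIcc 0 t) := by
  refine ((continuousOn_const (c := f 0)).add (intervalIntegral.continuousOn_primitive_interval'
    (hf.intervalIntegrable t ht) Set.left_mem_uIcc)).congr fun s hs => ?_
  rw [Set.uIcc_of_le ht] at hs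
  exact hf.eq_add_integral s hs.1

theorem congr {h h' : ℝ → E} (hf : HasIntegralDeriv f f') (hh : ∀ t, 0 ≤ t → h t = f t)
    (hh' : ∀ t, 0 ≤ t → h' t = f' t) : HasIntegralDeriv h h' := by
  have heq : ∀ t, 0 ≤ t → Set.EqOn f' h' (Set.uIoc 0 t) := fun t ht s hs =>
    (hh' s (by rw [Set.uIoc_of_le ht] at hs; exact hs.1.le)).symm
  refine ⟨fun t ht => (hf.intervalIntegrable t ht).congr (heq t ht), fun t ht => ?_⟩
  rw [hh t ht, hh 0 le_rfl, hf.eq_add_integral t ht,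
    intervalIntegral.integral_congr_ae (ae_of_all _ (heq t ht))]

theorem add {h h' : ℝ → E} (hf : HasIntegralDeriv f f') (hh : HasIntegralDeriv h h') :
    HasIntegralDeriv (fun t => f t + h t) (fun t => f' t + h' t) := by
  refine ⟨fun t ht => (hf.intervalIntegrable t ht).add (hh.intervalIntegrable t ht),
    fun t ht => ?_⟩
  rw [intervalIntegral.integral_add (hf.intervalIntegrable t ht) (hh.intervalIntegrable t ht),
    hf.eq_add_integral t ht, hh.eq_add_integral t ht]
  abel

theorem clm_comp [CompleteSpace E] [CompleteSpace F] (hf : HasIntegralDeriv f f')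
    (L : E →L[ℝ] F) : HasIntegralDeriv (fun t => L (f t)) (fun t => L (f' t)) := by
  refine ⟨fun t ht => ?_, fun t ht => ?_⟩
  · have hi := hf.intervalIntegrable t ht
    exact ⟨L.integrable_comp hi.1, L.integrable_comp hi.2⟩
  · rw [hf.eq_add_integral t ht, map_add,
      L.intervalIntegral_comp_comm (hf.intervalIntegrable t ht)]

theorem of_hasDerivAt [CompleteSpace E] (hf : ∀ t, HasDerivAt f (f' t) t) (hf' : Continuous f') :
    HasIntegralDeriv f f' := by
  refine ⟨fun t _ => hf'.intervalIntegrable _ _, fun t _ => ?_⟩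
  rw [intervalIntegral.integral_eq_sub_of_hasDerivAt (fun s _ => hf s)
    (hf'.intervalIntegrable _ _)]
  abel

section Bilin

variable [CompleteSpace E] [CompleteSpace F] [CompleteSpace G] (L : E →L[ℝ] F →L[ℝ] G)

theorem integral_bilin_deriv_left (hf : HasIntegralDeriv f f') (hg : HasIntegralDeriv g g')
    {t : ℝ} (ht : 0 ≤ t) :
    ∫ s in (0 : ℝ)..t, L (f' s) (g s)
      = L (f t - f 0) (g 0) + ∫ s in (0 : ℝ)..t, L (f t - f s) (g' s) := by
  have hfi := hf.intervalIntegrable t ht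
  have hgi := hg.intervalIntegrable t ht
  have hprim : ContinuousOn (fun s => ∫ r in (0 : ℝ)..s, g' r) (Set.uIcc 0 t) :=
    intervalIntegral.continuousOn_primitive_interval' hgi Set.left_mem_uIcc
  calc ∫ s in (0 : ℝ)..t, L (f' s) (g s)
      = ∫ s in (0 : ℝ)..t, (L.flip (g 0) (f' s) + L (f' s) (∫ r in (0 : ℝ)..s, g' r)) :=
        intervalIntegral.integral_congr fun s hs => by
          rw [Set.uIcc_of_le ht] at hs
          simp only [hg.eq_add_integral s hs.1, map_add, L.flip_apply]
    _ = L (f t - f 0) (g 0) + ∫ s in (0 : ℝ)..t, L (∫ r in s..t, f' r) (g' s) := by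
        rw [intervalIntegral.integral_add (g := fun s => L (f' s) (∫ r in (0 : ℝ)..s, g' r))
            (intervalIntegrable_bilin L.flip continuousOn_const hfi)
            (intervalIntegrable_bilin L.flip hprim hfi),
          ContinuousLinearMap.intervalIntegral_comp_comm _ hfi, L.flip_apply,
          ← hf.sub_eq_integral le_rfl ht, integral_bilin_triangle_swap L ht hfi hgi]
    _ = _ := by
        congr 1
        refine intervalIntegral.integral_congr fun s hs => ?_
        rw [Set.uIcc_of_le ht] at hs
        simp only [hf.sub_eq_integral hs.1 ht]

theorem bilin (hf : HasIntegralDeriv f f') (hg : HasIntegralDeriv g g') :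
    HasIntegralDeriv (fun t => L (f t) (g t)) (fun t => L (f' t) (g t) + L (f t) (g' t)) := by
  have hleft (t : ℝ) (ht : 0 ≤ t) : IntervalIntegrable (fun s => L (f' s) (g s)) volume 0 t :=
    intervalIntegrable_bilin L.flip (hg.continuousOn_uIcc ht) (hf.intervalIntegrable t ht)
  have hright (t : ℝ) (ht : 0 ≤ t) : IntervalIntegrable (fun s => L (f s) (g' s)) volume 0 t :=
    intervalIntegrable_bilin L (hf.continuousOn_uIcc ht) (hg.intervalIntegrable t ht)
  refine ⟨fun t ht => (hleft t ht).add (hright t ht), fun t ht => ?_⟩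
  have hgi := hg.intervalIntegrable t ht
  have hsplit : ∫ s in (0 : ℝ)..t, L (f t - f s) (g' s)
      = L (f t) (g t - g 0) - ∫ s in (0 : ℝ)..t, L (f s) (g' s) := by
    simp only [map_sub, sub_apply]
    rw [intervalIntegral.integral_sub (intervalIntegrable_bilin L continuousOn_const hgi)
      (hright t ht), ContinuousLinearMap.intervalIntegral_comp_comm _ hgi,
      ← hg.sub_eq_integral le_rfl ht, map_sub]
  rw [intervalIntegral.integral_add (hleft t ht) (hright t ht),
    hf.integral_bilin_deriv_left L hg ht, hsplit]
  simp only [map_sub, sub_apply]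
  abel

end Bilin

theorem le_exp {V V' : ℝ → ℝ} {ξ : ℝ} (hV : HasIntegralDeriv V V')
    (hVV' : ∀ t, 0 ≤ t → V' t ≤ -ξ * V t) {t : ℝ} (ht : 0 ≤ t) :
    V t ≤ V 0 * Real.exp (-ξ * t) := by
  have hexp : HasIntegralDeriv (fun t => Real.exp (ξ * t)) (fun t => Real.exp (ξ * t) * ξ) :=
    .of_hasDerivAt (fun t => by simpa using ((hasDerivAt_id t).const_mul ξ).exp) (by fun_prop)
  have hweighted := hexp.bilin (.mul ℝ ℝ) hV
  have hnonneg : 0 ≤ ∫ s in (0 : ℝ)..t,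
      -(Real.exp (ξ * s) * ξ * V s + Real.exp (ξ * s) * V' s) := by
    refine intervalIntegral.integral_nonneg ht fun s hs => ?_
    have := mul_nonneg (Real.exp_pos (ξ * s)).le (sub_nonneg.2 (hVV' s hs.1))
    linarith
  have hmono : Real.exp (ξ * t) * V t ≤ V 0 := by
    have heq := hweighted.eq_add_integral t ht
    rw [intervalIntegral.integral_neg] at hnonneg
    simp only [ContinuousLinearMap.mul_apply', mul_zero, Real.exp_zero, one_mul] at heq
    linarith
  rwa [neg_mul, Real.exp_neg, ← div_eq_mul_inv, le_div_iff₀ (Real.exp_pos _), mul_comm]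

end HasIntegralDeriv

end IntegralDeriv

section OperatorExp

variable {E : Type*} [NormedAddCommGroup E] [NormedSpace ℝ E] {A A' : E →L[ℝ] E} {D M s : ℝ}

theorem norm_exp_clm_le (A : E →L[ℝ] E) : ‖NormedSpace.exp A‖ ≤ Real.exp ‖A‖ := by
  rw [NormedSpace.exp_eq_tsum ℝ, Real.exp_eq_exp_ℝ, NormedSpace.exp_eq_tsum ℝ]
  refine tsum_of_norm_bounded (NormedSpace.expSeries_summable' ‖A‖).hasSum fun k => ?_
  rw [norm_smul, norm_inv, RCLike.norm_natCast, smul_eq_mul]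
  gcongr
  -- `norm_pow_le` needs `NormOneClass`, which fails for trivial `E`.
  cases k with
  | zero => rw [pow_zero, pow_zero]; exact ContinuousLinearMap.norm_id_le
  | succ k => exact norm_pow_le' A k.succ_pos

theorem norm_exp_smul_le (hA : ‖A‖ ≤ M) (hs : |s| ≤ D) :
    ‖NormedSpace.exp (s • A)‖ ≤ Real.exp (D * M) := by
  refine (norm_exp_clm_le _).trans (Real.exp_le_exp.2 ?_)
  rw [norm_smul, Real.norm_eq_abs]
  exact mul_le_mul hs hA (norm_nonneg _) ((abs_nonneg s).trans hs)

variable [CompleteSpace E]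

theorem exp_smul_exp_smul_apply (A : E →L[ℝ] E) (s t : ℝ) (y : E) :
    NormedSpace.exp (s • A) (NormedSpace.exp (t • A) y) = NormedSpace.exp ((s + t) • A) y := by
  let _ : NormedAlgebra ℚ (E →L[ℝ] E) := .restrictScalars ℚ ℝ _
  rw [add_smul, NormedSpace.exp_add_of_commute (((Commute.refl A).smul_left s).smul_right t)]
  rfl

theorem continuous_exp_smul (A : E →L[ℝ] E) :
    Continuous fun s : ℝ => NormedSpace.exp (s • A) :=
  continuous_iff_continuousAt.2 fun t => (hasDerivAt_exp_smul_const (𝕂 := ℝ) A t).continuousAt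

theorem hasDerivAt_exp_smul_mul_exp_sub_smul (A A' : E →L[ℝ] E) (s r : ℝ) :
    HasDerivAt (fun r : ℝ => NormedSpace.exp (r • A) * NormedSpace.exp ((s - r) • A'))
      (NormedSpace.exp (r • A) * (A - A') * NormedSpace.exp ((s - r) • A')) r := by
  have hleft := hasDerivAt_exp_smul_const (𝕂 := ℝ) A r
  have hright := (hasDerivAt_exp_smul_const' (𝕂 := ℝ) A' (s - r)).scomp r
    ((hasDerivAt_id r).const_sub s)
  refine (hleft.mul hright).congr_deriv ?_
  simp only [Function.comp_def, neg_smul, one_smul]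
  noncomm_ring

theorem norm_exp_smul_sub_exp_smul_le (hA : ‖A‖ ≤ M) (hA' : ‖A'‖ ≤ M) (hs : 0 ≤ s)
    (hsD : s ≤ D) :
    ‖NormedSpace.exp (s • A) - NormedSpace.exp (s • A')‖
      ≤ D * Real.exp (D * M) * ‖A - A'‖ := by
  have hM : 0 ≤ M := (norm_nonneg A).trans hA
  have hD : 0 ≤ D := hs.trans hsD
  have hbound : ∀ r ∈ Set.Ico 0 s,
      ‖NormedSpace.exp (r • A) * (A - A') * NormedSpace.exp ((s - r) • A')‖
        ≤ Real.exp (s * M) * ‖A - A'‖ := fun r hr => by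
    have hleft := norm_exp_smul_le hA (abs_of_nonneg hr.1).le
    have hright := norm_exp_smul_le hA' (abs_of_nonneg (sub_nonneg.2 hr.2.le)).le
    calc _ ≤ ‖NormedSpace.exp (r • A)‖ * ‖A - A'‖ * ‖NormedSpace.exp ((s - r) • A')‖ :=
          norm_mul₃_le
      _ ≤ Real.exp (r * M) * ‖A - A'‖ * Real.exp ((s - r) * M) := by gcongr
      _ = Real.exp (r * M + (s - r) * M) * ‖A - A'‖ := by rw [Real.exp_add]; ring
      _ = Real.exp (s * M) * ‖A - A'‖ := by ring_nf
  have hmean := norm_image_sub_le_of_norm_deriv_le_segment'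
    (fun r _ => (hasDerivAt_exp_smul_mul_exp_sub_smul A A' s r).hasDerivWithinAt) hbound s
    ⟨hs, le_rfl⟩
  calc _ ≤ Real.exp (s * M) * ‖A - A'‖ * s := by
        simpa [NormedSpace.exp_zero] using hmean
    _ = s * Real.exp (s * M) * ‖A - A'‖ := by ring
    _ ≤ D * Real.exp (D * M) * ‖A - A'‖ := by gcongr

end OperatorExp

section Input

variable {E F : Type*} [NormedAddCommGroup E] [NormedSpace ℝ E]
  [NormedAddCommGroup F] {D t : ℝ} {U : ℝ → F}

/-- The `L²` norm of the input over the delay window `[t - D, t]`. -/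
noncomputable def inputNorm (D : ℝ) (U : ℝ → F) (t : ℝ) : ℝ := √(∫ θ in (t - D)..t, ‖U θ‖ ^ 2)

theorem inputNorm_nonneg (D : ℝ) (U : ℝ → F) (t : ℝ) : 0 ≤ inputNorm D U t := Real.sqrt_nonneg _

theorem sq_inputNorm (hD : 0 ≤ D) (U : ℝ → F) (t : ℝ) :
    inputNorm D U t ^ 2 = ∫ θ in (t - D)..t, ‖U θ‖ ^ 2 :=
  Real.sq_sqrt (intervalIntegral.integral_nonneg (by linarith) fun _ _ => sq_nonneg _)

theorem integral_norm_le_sqrt_mul_sqrt {a b : ℝ} (hab : a ≤ b)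
    (hU : MemLp U 2 (volume.restrict (Set.Ioc a b))) :
    ∫ θ in a..b, ‖U θ‖ ≤ √(b - a) * √(∫ θ in a..b, ‖U θ‖ ^ 2) := by
  have hholder := integral_mul_norm_le_Lp_mul_Lq (μ := volume.restrict (Set.Ioc a b))
    (f := fun _ : ℝ => (1 : ℝ)) (g := fun θ => ‖U θ‖) Real.HolderConjugate.two_two
    (memLp_const _) (by simpa using hU.norm)
  simpa [intervalIntegral.integral_of_le hab, Real.sqrt_eq_rpow, hab] using hholder

theorem norm_integral_clm_apply_le [NormedSpace ℝ F] (hD : 0 ≤ D) {C : ℝ} {Φ : ℝ → F →L[ℝ] E}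
    (hU : MemLp U 2 (volume.restrict (Set.Ioc (t - D) t)))
    (hΦ : ∀ θ ∈ Set.Ioc (t - D) t, ‖Φ θ‖ ≤ C) (hC : 0 ≤ C) :
    ‖∫ θ in (t - D)..t, Φ θ (U θ)‖ ≤ C * (√D * inputNorm D U t) := by
  have hle : t - D ≤ t := by linarith
  have hint : IntervalIntegrable (fun θ => ‖U θ‖) volume (t - D) t := by
    rw [intervalIntegrable_iff_integrableOn_Ioc_of_le hle]
    exact (hU.integrable one_le_two).norm
  calc _ ≤ ∫ θ in (t - D)..t, C * ‖U θ‖ :=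
        intervalIntegral.norm_integral_le_of_norm_le hle
          (ae_of_all _ fun θ hθ => (Φ θ).le_of_opNorm_le (hΦ θ hθ) _) (hint.const_mul C)
    _ = C * ∫ θ in (t - D)..t, ‖U θ‖ := intervalIntegral.integral_const_mul _ _
    _ ≤ _ := by
        gcongr
        simpa only [sub_sub_cancel, inputNorm] using integral_norm_le_sqrt_mul_sqrt hle hU

/-- Inputs on `[-D, ∞)` that are locally square integrable. -/
def IsAdmissibleInput (D : ℝ) (U : ℝ → F) : Prop :=
  ∀ t, 0 ≤ t → MemLp U 2 (volume.restrict (Set.Icc (-D) t))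

namespace IsAdmissibleInput

theorem memLp_window (hU : IsAdmissibleInput D U) (ht : 0 ≤ t) :
    MemLp U 2 (volume.restrict (Set.Ioc (t - D) t)) :=
  (hU t ht).mono_measure (Measure.restrict_mono
    (Set.Ioc_subset_Icc_self.trans (Set.Icc_subset_Icc_left (by linarith))) le_rfl)

theorem intervalIntegrable (hU : IsAdmissibleInput D U) (hD : 0 ≤ D) (ht : 0 ≤ t) :
    IntervalIntegrable U volume (-D) t := by
  rw [intervalIntegrable_iff_integrableOn_Icc_of_le (by linarith)]
  exact (hU t ht).integrable one_le_two

theorem intervalIntegrable_norm_sq (hU : IsAdmissibleInput D U) (hD : 0 ≤ D) (ht : 0 ≤ t) :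
    IntervalIntegrable (fun θ => ‖U θ‖ ^ 2) volume (-D) t := by
  rw [intervalIntegrable_iff_integrableOn_Icc_of_le (by linarith)]
  exact (hU t ht).norm.integrable_sq

end IsAdmissibleInput

theorem intervalIntegrable_of_neg_le {h : ℝ → F}
    (hh : ∀ t, 0 ≤ t → IntervalIntegrable h volume (-D) t) {s t : ℝ} (hs : -D ≤ s) (ht : -D ≤ t) :
    IntervalIntegrable h volume s t := by
  have hfrom : ∀ r, -D ≤ r → IntervalIntegrable h volume (-D) r := fun r hr =>
    (hh (max r 0) (le_max_right _ _)).mono_set (Set.uIcc_subset_uIcc_left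
      (Set.mem_uIcc_of_le hr (le_max_left _ _)))
  exact (hfrom s hs).symm.trans (hfrom t ht)

theorem intervalIntegrable_delayed {h : ℝ → F}
    (hh : ∀ t, 0 ≤ t → IntervalIntegrable h volume (-D) t) (ht : 0 ≤ t) :
    IntervalIntegrable (fun s => h (s - D)) volume 0 t := by
  simpa using (intervalIntegrable_of_neg_le hh (s := -D) (t := t - D) le_rfl
    (by linarith)).comp_sub_right D

end Input

section WindowDuhamel

variable {E : Type*} [NormedAddCommGroup E] [NormedSpace ℝ E] {D : ℝ} {A : E →L[ℝ] E} {h : ℝ → E}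

theorem HasIntegralDeriv.window (hD : 0 ≤ D)
    (hh : ∀ t, 0 ≤ t → IntervalIntegrable h volume (-D) t) :
    HasIntegralDeriv (fun t => ∫ θ in (t - D)..t, h θ) (fun t => h t - h (t - D)) := by
  have hint {s t : ℝ} := intervalIntegrable_of_neg_le (s := s) (t := t) hh
  refine ⟨fun t ht => (hint (by linarith) (by linarith)).sub (intervalIntegrable_delayed hh ht),
    fun t ht => ?_⟩
  rw [intervalIntegral.integral_sub (hint (by linarith) (by linarith))
      (intervalIntegrable_delayed hh ht), intervalIntegral.integral_comp_sub_right,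
    intervalIntegral.integral_interval_sub_interval_comm' (hint (by linarith) (by linarith))
    (hint (by linarith) (by linarith)) (hint (by linarith) (by linarith)), add_sub_cancel]

/-- The last `D` time units of Duhamel's integral for `y' = A y + h`. -/
noncomputable def windowDuhamel (D : ℝ) (A : E →L[ℝ] E) (h : ℝ → E) (t : ℝ) : E :=
  ∫ θ in (t - D)..t, NormedSpace.exp ((t - θ) • A) (h θ)

variable [CompleteSpace E]

theorem intervalIntegrable_exp_smul_apply {φ : ℝ → ℝ} (hφ : Continuous φ) {a b : ℝ}
    (hh : IntervalIntegrable h volume a b) :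
    IntervalIntegrable (fun θ => NormedSpace.exp (φ θ • A) (h θ)) volume a b :=
  intervalIntegrable_bilin (.id ℝ (E →L[ℝ] E)) ((continuous_exp_smul A).comp hφ).continuousOn hh

theorem HasIntegralDeriv.windowDuhamel (hD : 0 ≤ D) (A : E →L[ℝ] E)
    (hh : ∀ t, 0 ≤ t → IntervalIntegrable h volume (-D) t) :
    HasIntegralDeriv (windowDuhamel D A h) (fun t =>
      A (windowDuhamel D A h t) + (h t - NormedSpace.exp (D • A) (h (t - D)))) := by
  have hexp : HasIntegralDeriv (fun t : ℝ => NormedSpace.exp (t • A))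
      (fun t => A * NormedSpace.exp (t • A)) :=
    .of_hasDerivAt (fun t => hasDerivAt_exp_smul_const' (𝕂 := ℝ) A t)
      (continuous_const.mul (continuous_exp_smul A))
  have hwindow := HasIntegralDeriv.window hD fun t ht =>
    intervalIntegrable_exp_smul_apply (A := A) continuous_neg (hh t ht)
  have hfactor (t : ℝ) (ht : 0 ≤ t) : SwitchedDelay.windowDuhamel D A h t
      = NormedSpace.exp (t • A) (∫ θ in (t - D)..t, NormedSpace.exp ((-θ) • A) (h θ)) := by
    rw [← ContinuousLinearMap.intervalIntegral_comp_comm _ (intervalIntegrable_exp_smul_apply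
      continuous_neg (intervalIntegrable_of_neg_le hh (by linarith) (by linarith)))]
    simp only [exp_smul_exp_smul_apply, SwitchedDelay.windowDuhamel, sub_eq_add_neg]
  refine (hexp.bilin (.id ℝ (E →L[ℝ] E)) hwindow).congr hfactor fun t ht => ?_
  have hzero : t + -t = 0 := by ring
  have hdelay : t + -(t - D) = D := by ring
  simp only [hfactor t ht, ContinuousLinearMap.id_apply, mul_apply_eq_comp, map_sub,
    exp_smul_exp_smul_apply, hzero, hdelay, zero_smul, NormedSpace.exp_zero,
    one_apply_eq_self]

end WindowDuhamel

section Predictor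

variable {E F : Type*} [NormedAddCommGroup E] [NormedSpace ℝ E]
  [NormedAddCommGroup F] [NormedSpace ℝ F]

/-- The exact predictor of the mode `(A, B)` with delay `D`, for operators between normed spaces. -/
noncomputable def opPredictor (D : ℝ) (A : E →L[ℝ] E) (B : F →L[ℝ] E) (x : ℝ → E) (U : ℝ → F)
    (t : ℝ) : E :=
  NormedSpace.exp (D • A) (x t) + windowDuhamel D A (fun θ => B (U θ)) t

variable {D M ε t : ℝ} {A A' : E →L[ℝ] E} {B B' : F →L[ℝ] E} {x : ℝ → E} {U : ℝ → F}

theorem norm_windowDuhamel_le (hD : 0 ≤ D) (hA : ‖A‖ ≤ M) (hB : ‖B‖ ≤ M)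
    (hU : MemLp U 2 (volume.restrict (Set.Ioc (t - D) t))) :
    ‖windowDuhamel D A (fun θ => B (U θ)) t‖
      ≤ Real.exp (D * M) * M * (√D * inputNorm D U t) := by
  have hM : 0 ≤ M := (norm_nonneg A).trans hA
  refine norm_integral_clm_apply_le (Φ := fun θ => NormedSpace.exp ((t - θ) • A) ∘L B) hD hU
    (fun θ hθ => ?_) (by positivity)
  have hexp : ‖NormedSpace.exp ((t - θ) • A)‖ ≤ Real.exp (D * M) :=
    norm_exp_smul_le hA (by rw [abs_of_nonneg] <;> linarith [hθ.1, hθ.2])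
  exact (ContinuousLinearMap.opNorm_comp_le _ _).trans (by gcongr)

theorem norm_opPredictor_le (hD : 0 ≤ D) (hA : ‖A‖ ≤ M) (hB : ‖B‖ ≤ M)
    (hU : MemLp U 2 (volume.restrict (Set.Ioc (t - D) t))) :
    ‖opPredictor D A B x U t‖
      ≤ Real.exp (D * M) * (‖x t‖ + M * (√D * inputNorm D U t)) :=
  calc _ ≤ Real.exp (D * M) * ‖x t‖ + Real.exp (D * M) * M * (√D * inputNorm D U t) :=
        (norm_add_le _ _).trans (add_le_add
          (ContinuousLinearMap.le_of_opNorm_le _ (norm_exp_smul_le hA (abs_of_nonneg hD).le) _)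
          (norm_windowDuhamel_le hD hA hB hU))
    _ = _ := by ring

/-- A common constant for the estimates relating `(x, U)` to `(p, U)` for a predictor `p`, and
comparing the predictors of two modes. -/
noncomputable def predictorBound (D M : ℝ) : ℝ :=
  Real.exp (D * M) ^ 2 * (1 + D) * (1 + M) * (1 + √D)

/-- With `e^{D M} = 1 + γ` and everything expanded, bounds by `predictorBound D M` only compare
nonnegative coefficients. -/
theorem exists_exp_eq_one_add (hD : 0 ≤ D) (hM : 0 ≤ M) :
    ∃ γ, 0 ≤ γ ∧ Real.exp (D * M) = 1 + γ :=
  ⟨Real.exp (D * M) - 1, sub_nonneg.2 (Real.one_le_exp (by positivity)), by ring⟩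

theorem exp_le_predictorBound (hD : 0 ≤ D) (hM : 0 ≤ M) :
    Real.exp (D * M) ≤ predictorBound D M := by
  obtain ⟨γ, hγ, hexp⟩ := exists_exp_eq_one_add hD hM
  rw [predictorBound, hexp, ← sub_nonneg]
  ring_nf
  positivity

theorem one_le_predictorBound (hD : 0 ≤ D) (hM : 0 ≤ M) : 1 ≤ predictorBound D M :=
  (Real.one_le_exp (by positivity)).trans (exp_le_predictorBound hD hM)

theorem norm_opPredictor_add_inputNorm_le (hD : 0 ≤ D) (hA : ‖A‖ ≤ M) (hB : ‖B‖ ≤ M)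
    (hU : MemLp U 2 (volume.restrict (Set.Ioc (t - D) t))) :
    ‖opPredictor D A B x U t‖ + inputNorm D U t
      ≤ predictorBound D M * (‖x t‖ + inputNorm D U t) := by
  have hM : 0 ≤ M := (norm_nonneg A).trans hA
  have hu := inputNorm_nonneg D U t
  obtain ⟨γ, hγ, hexp⟩ := exists_exp_eq_one_add hD hM
  refine (add_le_add_left (norm_opPredictor_le hD hA hB hU) _).trans ?_
  rw [predictorBound, hexp, ← sub_nonneg]
  ring_nf
  positivity

variable [CompleteSpace E]

theorem norm_le_norm_opPredictor (hD : 0 ≤ D) (hA : ‖A‖ ≤ M) (hB : ‖B‖ ≤ M)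
    (hU : MemLp U 2 (volume.restrict (Set.Ioc (t - D) t))) :
    ‖x t‖ ≤ Real.exp (D * M)
      * (‖opPredictor D A B x U t‖ + Real.exp (D * M) * M * (√D * inputNorm D U t)) := by
  have hx : x t = NormedSpace.exp ((-D) • A)
      (opPredictor D A B x U t - windowDuhamel D A (fun θ => B (U θ)) t) := by
    rw [opPredictor, add_sub_cancel_right, exp_smul_exp_smul_apply, neg_add_cancel, zero_smul,
      NormedSpace.exp_zero, one_apply_eq_self]
  calc ‖x t‖ ≤ Real.exp (D * M)
        * ‖opPredictor D A B x U t - windowDuhamel D A (fun θ => B (U θ)) t‖ := by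
        conv_lhs => rw [hx]
        exact ContinuousLinearMap.le_of_opNorm_le _
          (norm_exp_smul_le hA (by rw [abs_neg, abs_of_nonneg hD])) _
    _ ≤ _ := by
        gcongr
        exact (norm_sub_le _ _).trans (add_le_add le_rfl (norm_windowDuhamel_le hD hA hB hU))

theorem norm_exp_smul_comp_sub_le (hB : ‖B‖ ≤ M) (hA : ‖A‖ ≤ M) (hA' : ‖A'‖ ≤ M)
    (hAA' : ‖A - A'‖ ≤ ε) (hBB' : ‖B - B'‖ ≤ ε) {s : ℝ} (hs : 0 ≤ s) (hsD : s ≤ D) :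
    ‖NormedSpace.exp (s • A) ∘L B - NormedSpace.exp (s • A') ∘L B'‖
      ≤ Real.exp (D * M) * ε * (D * M + 1) := by
  have hD : 0 ≤ D := hs.trans hsD
  have hε : 0 ≤ ε := (norm_nonneg _).trans hAA'
  calc _ = ‖(NormedSpace.exp (s • A) - NormedSpace.exp (s • A')) ∘L B
          + NormedSpace.exp (s • A') ∘L (B - B')‖ := by
        rw [ContinuousLinearMap.sub_comp, ContinuousLinearMap.comp_sub, sub_add_sub_cancel]
    _ ≤ D * Real.exp (D * M) * ε * M + Real.exp (D * M) * ε := by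
        refine (norm_add_le _ _).trans (add_le_add ?_ ?_)
        · refine (ContinuousLinearMap.opNorm_comp_le _ _).trans ?_
          gcongr
          exact (norm_exp_smul_sub_exp_smul_le hA hA' hs hsD).trans (by gcongr)
        · refine (ContinuousLinearMap.opNorm_comp_le _ _).trans ?_
          gcongr
          exact norm_exp_smul_le hA' ((abs_of_nonneg hs).trans_le hsD)
    _ = _ := by ring

theorem norm_opPredictor_sub_le (hD : 0 ≤ D) (hA : ‖A‖ ≤ M) (hB : ‖B‖ ≤ M) (hA' : ‖A'‖ ≤ M)
    (hAA' : ‖A - A'‖ ≤ ε) (hBB' : ‖B - B'‖ ≤ ε)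
    (hU : MemLp U 2 (volume.restrict (Set.Ioc (t - D) t))) :
    ‖opPredictor D A B x U t - opPredictor D A' B' x U t‖
      ≤ Real.exp (D * M) * ε * (D * ‖x t‖ + (D * M + 1) * (√D * inputNorm D U t)) := by
  have hM : 0 ≤ M := (norm_nonneg A).trans hA
  have hε : 0 ≤ ε := (norm_nonneg _).trans hAA'
  have hint (A : E →L[ℝ] E) (B : F →L[ℝ] E) :
      IntervalIntegrable (fun θ => NormedSpace.exp ((t - θ) • A) (B (U θ))) volume (t - D) t := by
    refine intervalIntegrable_exp_smul_apply (continuous_const.sub continuous_id) ?_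
    rw [intervalIntegrable_iff_integrableOn_Ioc_of_le (by linarith)]
    exact B.integrable_comp (hU.integrable one_le_two)
  have hsplit : opPredictor D A B x U t - opPredictor D A' B' x U t
      = (NormedSpace.exp (D • A) - NormedSpace.exp (D • A')) (x t)
        + ∫ θ in (t - D)..t, (NormedSpace.exp ((t - θ) • A) ∘L B
            - NormedSpace.exp ((t - θ) • A') ∘L B') (U θ) := by
    simp only [opPredictor, windowDuhamel, sub_apply, ContinuousLinearMap.comp_apply]
    rw [intervalIntegral.integral_sub (hint A B) (hint A' B')]
    abel
  have hstate : ‖(NormedSpace.exp (D • A) - NormedSpace.exp (D • A')) (x t)‖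
      ≤ D * Real.exp (D * M) * ε * ‖x t‖ :=
    ContinuousLinearMap.le_of_opNorm_le _
      ((norm_exp_smul_sub_exp_smul_le hA hA' hD le_rfl).trans (by gcongr)) _
  have hinput := norm_integral_clm_apply_le hD hU (fun θ hθ => norm_exp_smul_comp_sub_le hB hA hA'
    hAA' hBB' (sub_nonneg.2 hθ.2) (sub_le_comm.1 hθ.1.le)) (by positivity)
  calc _ ≤ D * Real.exp (D * M) * ε * ‖x t‖
        + Real.exp (D * M) * ε * (D * M + 1) * (√D * inputNorm D U t) := by
        rw [hsplit]
        exact (norm_add_le _ _).trans (add_le_add hstate hinput)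
    _ = _ := by ring

theorem norm_add_inputNorm_le (hD : 0 ≤ D) (hA : ‖A‖ ≤ M) (hB : ‖B‖ ≤ M)
    (hU : MemLp U 2 (volume.restrict (Set.Ioc (t - D) t))) :
    ‖x t‖ + inputNorm D U t
      ≤ predictorBound D M * (‖opPredictor D A B x U t‖ + inputNorm D U t) := by
  have hM : 0 ≤ M := (norm_nonneg A).trans hA
  have hu := inputNorm_nonneg D U t
  obtain ⟨γ, hγ, hexp⟩ := exists_exp_eq_one_add hD hM
  refine (add_le_add_left (norm_le_norm_opPredictor hD hA hB hU) _).trans ?_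
  rw [predictorBound, hexp, ← sub_nonneg]
  ring_nf
  positivity

theorem norm_opPredictor_sub_le_predictorBound (hD : 0 ≤ D) (hA : ‖A‖ ≤ M) (hB : ‖B‖ ≤ M)
    (hA' : ‖A'‖ ≤ M) (hAA' : ‖A - A'‖ ≤ ε) (hBB' : ‖B - B'‖ ≤ ε)
    (hU : MemLp U 2 (volume.restrict (Set.Ioc (t - D) t))) :
    ‖opPredictor D A B x U t - opPredictor D A' B' x U t‖
      ≤ predictorBound D M * ε * (‖x t‖ + inputNorm D U t) := by
  have hM : 0 ≤ M := (norm_nonneg A).trans hA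
  have hε : 0 ≤ ε := (norm_nonneg _).trans hAA'
  have hu := inputNorm_nonneg D U t
  obtain ⟨γ, hγ, hexp⟩ := exists_exp_eq_one_add hD hM
  refine (norm_opPredictor_sub_le hD hA hB hA' hAA' hBB' hU).trans ?_
  rw [predictorBound, hexp, ← sub_nonneg]
  ring_nf
  positivity

theorem HasIntegralDeriv.opPredictor (hD : 0 ≤ D) (hU : IsAdmissibleInput D U) {d : ℝ → E}
    (hx : HasIntegralDeriv x fun t => A (x t) + B (U (t - D)) + d t) :
    HasIntegralDeriv (opPredictor D A B x U) (fun t =>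
      A (opPredictor D A B x U t) + B (U t) + NormedSpace.exp (D • A) (d t)) := by
  have hBU (t : ℝ) (ht : 0 ≤ t) : IntervalIntegrable (fun θ => B (U θ)) volume (-D) t := by
    have hi := hU.intervalIntegrable hD ht
    exact ⟨B.integrable_comp hi.1, B.integrable_comp hi.2⟩
  have hcomm (y : E) : A (NormedSpace.exp (D • A) y) = NormedSpace.exp (D • A) (A y) :=
    congrArg (fun T : E →L[ℝ] E => T y) ((Commute.refl A).smul_right D).exp_right.eq
  refine ((hx.clm_comp (NormedSpace.exp (D • A))).add (.windowDuhamel hD A hBU)).congr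
    (fun t _ => rfl) fun t _ => ?_
  simp only [SwitchedDelay.opPredictor, map_add, hcomm]
  abel

end Predictor

section WeightedEnergy

variable {F : Type*} [NormedAddCommGroup F] {D t : ℝ} {U : ℝ → F}

/-- The exponentially weighted input energy `∫ e^{θ-t} |U(θ)|² dθ` over the delay window. -/
noncomputable def weightedEnergy (D : ℝ) (U : ℝ → F) (t : ℝ) : ℝ :=
  ∫ θ in (t - D)..t, Real.exp (θ - t) * ‖U θ‖ ^ 2

theorem exp_smul_neg_id_apply (s y : ℝ) :
    NormedSpace.exp (s • -ContinuousLinearMap.id ℝ ℝ) y = Real.exp (-s) * y := by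
  have hscalar : s • -ContinuousLinearMap.id ℝ ℝ = algebraMap ℝ (ℝ →L[ℝ] ℝ) (-s) := by
    rw [Algebra.algebraMap_eq_smul_one, smul_neg, neg_smul]
    rfl
  rw [hscalar, ← NormedSpace.algebraMap_exp_comm, ← Real.exp_eq_exp_ℝ,
    Algebra.algebraMap_eq_smul_one, smul_apply, one_apply_eq_self, smul_eq_mul]

theorem weightedEnergy_eq_windowDuhamel (D : ℝ) (U : ℝ → F) :
    weightedEnergy D U = windowDuhamel D (-.id ℝ ℝ) (fun θ => ‖U θ‖ ^ 2) := by
  ext t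
  simp only [weightedEnergy, windowDuhamel, exp_smul_neg_id_apply, neg_sub]

theorem hasIntegralDeriv_weightedEnergy (hD : 0 ≤ D) (hU : IsAdmissibleInput D U) :
    HasIntegralDeriv (weightedEnergy D U) (fun t =>
      -weightedEnergy D U t + (‖U t‖ ^ 2 - Real.exp (-D) * ‖U (t - D)‖ ^ 2)) := by
  have h := HasIntegralDeriv.windowDuhamel hD (-.id ℝ ℝ) fun _ =>
    hU.intervalIntegrable_norm_sq hD
  simpa only [← weightedEnergy_eq_windowDuhamel, exp_smul_neg_id_apply, neg_apply,
    ContinuousLinearMap.id_apply] using h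

theorem intervalIntegrable_weightedEnergy (hD : 0 ≤ D) (hU : IsAdmissibleInput D U) (ht : 0 ≤ t) :
    IntervalIntegrable (fun θ => Real.exp (θ - t) * ‖U θ‖ ^ 2) volume (t - D) t :=
  (intervalIntegrable_of_neg_le (fun _ => hU.intervalIntegrable_norm_sq hD) (by linarith)
    (by linarith)).continuousOn_mul (by fun_prop)

theorem weightedEnergy_le (hD : 0 ≤ D) (hU : IsAdmissibleInput D U) (ht : 0 ≤ t) :
    weightedEnergy D U t ≤ inputNorm D U t ^ 2 := by
  rw [sq_inputNorm hD]
  refine intervalIntegral.integral_mono_on (by linarith)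
    (intervalIntegrable_weightedEnergy hD hU ht)
    (intervalIntegrable_of_neg_le (fun _ => hU.intervalIntegrable_norm_sq hD) (by linarith)
      (by linarith)) fun θ hθ => ?_
  exact mul_le_of_le_one_left (sq_nonneg _) (Real.exp_le_one_iff.2 (sub_nonpos.2 hθ.2))

theorem exp_neg_mul_le_weightedEnergy (hD : 0 ≤ D) (hU : IsAdmissibleInput D U) (ht : 0 ≤ t) :
    Real.exp (-D) * inputNorm D U t ^ 2 ≤ weightedEnergy D U t := by
  rw [sq_inputNorm hD, ← intervalIntegral.integral_const_mul]
  refine intervalIntegral.integral_mono_on (by linarith)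
    ((intervalIntegrable_of_neg_le (fun _ => hU.intervalIntegrable_norm_sq hD) (by linarith)
      (by linarith)).const_mul _) (intervalIntegrable_weightedEnergy hD hU ht) fun θ hθ => ?_
  gcongr
  linarith [hθ.1]

end WeightedEnergy

section TargetSystem

open scoped InnerProductSpace

variable {E F : Type*} [NormedAddCommGroup E] [InnerProductSpace ℝ E] [NormedAddCommGroup F]

/-- A perturbation of size `η` of the delay-free loop `p' = H p`, `U = K p` with `‖K‖ ≤ κ`: the
derivative `p'` may also depend on the input history and on the delayed input. -/
structure IsPerturbedTarget (D : ℝ) (H : E →L[ℝ] E) (κ η : ℝ) (p p' : ℝ → E) (U : ℝ → F) :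
    Prop where
  input : IsAdmissibleInput D U
  hasIntegralDeriv : HasIntegralDeriv p p'
  drift : ∀ t, 0 ≤ t → ‖p' t - H (p t)‖ ≤ η * (‖p t‖ + inputNorm D U t + ‖U (t - D)‖)
  feedback : ∀ t, 0 ≤ t → ‖U t‖ ≤ κ * ‖p t‖ + η * inputNorm D U t

/-- The Lyapunov functional of the perturbed target system; the weighted energy produces the
negative terms that absorb the input history and the delayed input. -/
noncomputable def lyapunovFunctional (D : ℝ) (P : E →L[ℝ] E) (a : ℝ) (p : ℝ → E) (U : ℝ → F)
    (t : ℝ) : ℝ :=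
  ⟪p t, P (p t)⟫_ℝ + a * weightedEnergy D U t

variable {D a c t : ℝ} {P H : E →L[ℝ] E} {p p' : ℝ → E} {U : ℝ → F}

theorem lyapunovFunctional_le (hD : 0 ≤ D) (ha : 0 ≤ a) (hU : IsAdmissibleInput D U)
    (ht : 0 ≤ t) :
    lyapunovFunctional D P a p U t ≤ (‖P‖ + a) * (‖p t‖ ^ 2 + inputNorm D U t ^ 2) := by
  have hquad : ⟪p t, P (p t)⟫_ℝ ≤ ‖P‖ * ‖p t‖ ^ 2 :=
    calc _ ≤ ‖p t‖ * (‖P‖ * ‖p t‖) :=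
          (real_inner_le_norm _ _).trans (by gcongr; exact P.le_opNorm _)
      _ = _ := by ring
  have henergy := mul_le_mul_of_nonneg_left (weightedEnergy_le hD hU ht) ha
  have hcross : 0 ≤ ‖P‖ * inputNorm D U t ^ 2 + a * ‖p t‖ ^ 2 := by positivity
  calc _ ≤ ‖P‖ * ‖p t‖ ^ 2 + a * inputNorm D U t ^ 2 := add_le_add hquad henergy
    _ ≤ _ := by linarith

theorem le_lyapunovFunctional (hD : 0 ≤ D) (ha : 0 ≤ a) (hU : IsAdmissibleInput D U)
    (hP : ∀ y, c * ‖y‖ ^ 2 ≤ ⟪y, P y⟫_ℝ) (ht : 0 ≤ t) :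
    min c (a * Real.exp (-D)) * (‖p t‖ ^ 2 + inputNorm D U t ^ 2)
      ≤ lyapunovFunctional D P a p U t := by
  have henergy := mul_le_mul_of_nonneg_left (exp_neg_mul_le_weightedEnergy hD hU ht) ha
  calc _ = min c (a * Real.exp (-D)) * ‖p t‖ ^ 2
        + min c (a * Real.exp (-D)) * inputNorm D U t ^ 2 := mul_add _ _ _
    _ ≤ c * ‖p t‖ ^ 2 + a * Real.exp (-D) * inputNorm D U t ^ 2 := by
        gcongr
        · exact min_le_left _ _
        · exact min_le_right _ _
    _ ≤ _ := add_le_add (hP _) (by rwa [mul_assoc])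

theorem hasIntegralDeriv_lyapunovFunctional [CompleteSpace E] (hD : 0 ≤ D)
    (hP : (P : E →ₗ[ℝ] E).IsSymmetric) (hU : IsAdmissibleInput D U)
    (hp : HasIntegralDeriv p p') :
    HasIntegralDeriv (lyapunovFunctional D P a p U) (fun t => 2 * ⟪P (p t), p' t⟫_ℝ
      + a * (-weightedEnergy D U t + (‖U t‖ ^ 2 - Real.exp (-D) * ‖U (t - D)‖ ^ 2))) := by
  have hquad := hp.bilin (innerSL ℝ) (hp.clm_comp P)
  have henergy := (hasIntegralDeriv_weightedEnergy hD hU).clm_comp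
    (ContinuousLinearMap.mul ℝ ℝ a)
  refine (hquad.add henergy).congr (fun t _ => rfl) fun t _ => ?_
  have hsymm : ⟪P (p t), p' t⟫_ℝ = ⟪p t, P (p' t)⟫_ℝ := hP _ _
  rw [innerSL_apply_apply, innerSL_apply_apply, ContinuousLinearMap.mul_apply', ← hsymm,
    real_inner_comm, two_mul]

theorem two_inner_le_of_drift {η q u v : ℝ} {y y' : E} (hη : 0 ≤ η)
    (hdiss : 2 * ⟪P y, H y⟫_ℝ ≤ -q * ‖y‖ ^ 2) (hdrift : ‖y' - H y‖ ≤ η * (‖y‖ + u + v)) :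
    2 * ⟪P y, y'⟫_ℝ ≤ -q * ‖y‖ ^ 2 + 4 * ‖P‖ * η * (‖y‖ ^ 2 + u ^ 2 + v ^ 2) := by
  have hpert : ⟪P y, y' - H y⟫_ℝ ≤ ‖P‖ * ‖y‖ * (η * (‖y‖ + u + v)) :=
    (real_inner_le_norm _ _).trans (by gcongr; exact P.le_opNorm y)
  have hyoung : ‖y‖ * (‖y‖ + u + v) ≤ 2 * (‖y‖ ^ 2 + u ^ 2 + v ^ 2) := by
    nlinarith [sq_nonneg (‖y‖ - u), sq_nonneg (‖y‖ - v), sq_nonneg u, sq_nonneg v]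
  calc 2 * ⟪P y, y'⟫_ℝ = 2 * ⟪P y, H y⟫_ℝ + 2 * ⟪P y, y' - H y⟫_ℝ := by rw [inner_sub_right]; ring
    _ ≤ -q * ‖y‖ ^ 2 + 2 * (‖P‖ * ‖y‖ * (η * (‖y‖ + u + v))) := by gcongr
    _ = -q * ‖y‖ ^ 2 + 2 * (‖P‖ * η) * (‖y‖ * (‖y‖ + u + v)) := by ring
    _ ≤ -q * ‖y‖ ^ 2 + 2 * (‖P‖ * η) * (2 * (‖y‖ ^ 2 + u ^ 2 + v ^ 2)) := by gcongr
    _ = _ := by ring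

theorem sq_le_of_feedback {κ η r u w : ℝ} (hη : 0 ≤ η) (hη₁ : η ≤ 1) (hw : 0 ≤ w)
    (hfeedback : w ≤ κ * r + η * u) : w ^ 2 ≤ 2 * κ ^ 2 * r ^ 2 + 2 * η * u ^ 2 :=
  calc w ^ 2 ≤ (κ * r + η * u) ^ 2 := by gcongr
    _ ≤ 2 * ((κ * r) ^ 2 + (η * u) ^ 2) := add_sq_le
    _ = 2 * κ ^ 2 * r ^ 2 + 2 * (η ^ 2 * u ^ 2) := by ring
    _ ≤ 2 * κ ^ 2 * r ^ 2 + 2 * (η * u ^ 2) := by gcongr; exact pow_le_of_le_one hη hη₁ two_ne_zero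
    _ = _ := by ring

theorem IsPerturbedTarget.lyapunov_deriv_le {κ η q m : ℝ} (h : IsPerturbedTarget D H κ η p p' U)
    (hD : 0 ≤ D) (ha : 0 ≤ a) (hη : 0 ≤ η) (hη₁ : η ≤ 1)
    (hηm : (4 * ‖P‖ + 2 * a) * η ≤ m / 2) (hmq : m ≤ q - 2 * a * κ ^ 2)
    (hma : m ≤ a * Real.exp (-D)) (hdiss : ∀ y, 2 * ⟪P y, H y⟫_ℝ ≤ -q * ‖y‖ ^ 2) (ht : 0 ≤ t) :
    2 * ⟪P (p t), p' t⟫_ℝ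
      + a * (-weightedEnergy D U t + (‖U t‖ ^ 2 - Real.exp (-D) * ‖U (t - D)‖ ^ 2))
      ≤ -(m / 2) * (‖p t‖ ^ 2 + inputNorm D U t ^ 2) := by
  have hquad := two_inner_le_of_drift hη (hdiss (p t)) (h.drift t ht)
  have hinput := sq_le_of_feedback hη hη₁ (norm_nonneg _) (h.feedback t ht)
  have henergy := exp_neg_mul_le_weightedEnergy hD h.input ht
  set r := ‖p t‖
  set u := inputNorm D U t
  set v := ‖U (t - D)‖
  have hsum : (4 * ‖P‖ + 2 * a) * η * (r ^ 2 + u ^ 2 + v ^ 2)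
      ≤ m / 2 * (r ^ 2 + u ^ 2 + v ^ 2) := by gcongr
  have hr : m * r ^ 2 ≤ (q - 2 * a * κ ^ 2) * r ^ 2 := by gcongr
  have hu : m * (u ^ 2 + v ^ 2) ≤ a * Real.exp (-D) * (u ^ 2 + v ^ 2) := by gcongr
  have hainput := mul_le_mul_of_nonneg_left hinput ha
  have haenergy := mul_le_mul_of_nonneg_left henergy ha
  have hm : 0 ≤ m := by
    have : 0 ≤ (4 * ‖P‖ + 2 * a) * η := by positivity
    linarith
  have haη : 0 ≤ a * η * (r ^ 2 + v ^ 2) := by positivity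
  have hmv : 0 ≤ m * v ^ 2 := by positivity
  linarith

theorem IsPerturbedTarget.sq_add_sq_le {κ η q m : ℝ} [CompleteSpace E]
    (h : IsPerturbedTarget D H κ η p p' U)
    (hD : 0 ≤ D) (hP : (P : E →ₗ[ℝ] E).IsSymmetric) (hc : 0 < c)
    (hPc : ∀ y, c * ‖y‖ ^ 2 ≤ ⟪y, P y⟫_ℝ) (ha : 0 < a) (hη : 0 ≤ η) (hη₁ : η ≤ 1)
    (hηm : (4 * ‖P‖ + 2 * a) * η ≤ m / 2) (hmq : m ≤ q - 2 * a * κ ^ 2)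
    (hma : m ≤ a * Real.exp (-D)) (hdiss : ∀ y, 2 * ⟪P y, H y⟫_ℝ ≤ -q * ‖y‖ ^ 2) (ht : 0 ≤ t) :
    ‖p t‖ ^ 2 + inputNorm D U t ^ 2 ≤ (‖P‖ + a) / min c (a * Real.exp (-D))
      * (‖p 0‖ ^ 2 + inputNorm D U 0 ^ 2) * Real.exp (-(m / (2 * (‖P‖ + a))) * t) := by
  have hm : 0 ≤ m := by
    have : 0 ≤ (4 * ‖P‖ + 2 * a) * η := by positivity
    linarith
  have hα : 0 < min c (a * Real.exp (-D)) := by positivity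
  have hderiv := hasIntegralDeriv_lyapunovFunctional (a := a) hD hP h.input h.hasIntegralDeriv
  have hdecay := hderiv.le_exp (ξ := m / (2 * (‖P‖ + a))) (fun s hs => by
    refine (h.lyapunov_deriv_le hD ha.le hη hη₁ hηm hmq hma hdiss hs).trans ?_
    have hV := lyapunovFunctional_le (P := P) (p := p) hD ha.le h.input hs
    calc _ = -(m / (2 * (‖P‖ + a))) * ((‖P‖ + a) * (‖p s‖ ^ 2 + inputNorm D U s ^ 2)) := by
          field_simp
      _ ≤ _ := mul_le_mul_of_nonpos_left hV (neg_nonpos.2 (by positivity))) ht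
  rw [div_mul_eq_mul_div, div_mul_eq_mul_div, le_div_iff₀ hα, mul_comm]
  calc _ ≤ lyapunovFunctional D P a p U t := le_lyapunovFunctional hD ha.le h.input hPc ht
    _ ≤ _ := hdecay
    _ ≤ _ := by
        gcongr
        exact lyapunovFunctional_le hD ha.le h.input le_rfl

theorem add_le_of_sq_add_sq_le {x y x₀ y₀ R ξ : ℝ} (hx₀ : 0 ≤ x₀) (hy₀ : 0 ≤ y₀) (hR : 0 ≤ R)
    (h : x ^ 2 + y ^ 2 ≤ R * (x₀ ^ 2 + y₀ ^ 2) * Real.exp (-ξ * t)) :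
    x + y ≤ √(2 * R) * (x₀ + y₀) * Real.exp (-(ξ / 2) * t) := by
  refine le_of_sq_le_sq ?_ (by positivity)
  have hexp : Real.exp (-(ξ / 2) * t) ^ 2 = Real.exp (-ξ * t) := by
    rw [← Real.exp_nat_mul]
    ring_nf
  have hsq : x₀ ^ 2 + y₀ ^ 2 ≤ (x₀ + y₀) ^ 2 := by nlinarith [mul_nonneg hx₀ hy₀]
  calc (x + y) ^ 2 ≤ 2 * (x ^ 2 + y ^ 2) := add_sq_le
    _ ≤ 2 * (R * (x₀ + y₀) ^ 2 * Real.exp (-ξ * t)) := by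
        gcongr
        exact h.trans (by gcongr)
    _ = _ := by
        rw [mul_pow, mul_pow, Real.sq_sqrt (by positivity), hexp]
        ring

theorem IsPerturbedTarget.exists_decay [CompleteSpace E] (F : Type*) [NormedAddCommGroup F]
    {q κ : ℝ} (hD : 0 ≤ D) (hP : (P : E →ₗ[ℝ] E).IsSymmetric) (hc : 0 < c)
    (hPc : ∀ y, c * ‖y‖ ^ 2 ≤ ⟪y, P y⟫_ℝ) (hq : 0 < q) (hκ : 0 < κ) :
    ∃ ηstar ρ ξ : ℝ, 0 < ηstar ∧ 0 < ρ ∧ 0 < ξ ∧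
      ∀ (H : E →L[ℝ] E) (η : ℝ) (p p' : ℝ → E) (U : ℝ → F), 0 ≤ η → η ≤ ηstar →
      (∀ y, 2 * ⟪P y, H y⟫_ℝ ≤ -q * ‖y‖ ^ 2) → IsPerturbedTarget D H κ η p p' U →
      ∀ t, 0 ≤ t → ‖p t‖ + inputNorm D U t
        ≤ ρ * (‖p 0‖ + inputNorm D U 0) * Real.exp (-ξ * t) := by
  -- With this weight, `‖U t‖ ≤ κ ‖p t‖ + ⋯` costs at most half of the dissipation `q ‖p t‖ ^ 2`.
  let a : ℝ := q / (4 * κ ^ 2)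
  let m : ℝ := min (q / 2) (a * Real.exp (-D))
  have ha : 0 < a := by positivity
  have hden : 0 < 4 * ‖P‖ + 2 * a := by positivity
  have hmq : m ≤ q - 2 * a * κ ^ 2 := (min_le_left _ _).trans_eq (by
    simp only [a]
    field_simp
    ring)
  refine ⟨min 1 (m / 2 / (4 * ‖P‖ + 2 * a)), √(2 * ((‖P‖ + a) / min c (a * Real.exp (-D)))),
    m / (2 * (‖P‖ + a)) / 2, by positivity, by positivity, by positivity,
    fun H η p p' U hη hηstar hdiss h t ht => ?_⟩
  have hηm : (4 * ‖P‖ + 2 * a) * η ≤ m / 2 :=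
    (le_div_iff₀' hden).1 (hηstar.trans (min_le_right _ _))
  exact add_le_of_sq_add_sq_le (norm_nonneg _) (inputNorm_nonneg _ _ _) (by positivity)
    (h.sq_add_sq_le hD hP hc hPc ha hη (hηstar.trans (min_le_left _ _)) hηm hmq
      (min_le_right _ _) hdiss ht)

end TargetSystem

section SwitchedLoop

open scoped InnerProductSpace

variable {ι E F : Type*} [NormedAddCommGroup E] [NormedAddCommGroup F] [NormedSpace ℝ F]

section NormedSpace

variable [NormedSpace ℝ E]

/-- The modes `(A i, B i, K i)` are bounded by `M` and lie within `ε` of the mode `j`. -/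
structure IsModeCluster (A : ι → E →L[ℝ] E) (B : ι → F →L[ℝ] E) (K : ι → E →L[ℝ] F) (j : ι)
    (M ε : ℝ) : Prop where
  norm_state_le : ∀ i, ‖A i‖ ≤ M
  norm_input_le : ∀ i, ‖B i‖ ≤ M
  norm_gain_le : ∀ i, ‖K i‖ ≤ M
  norm_state_sub_le : ∀ i, ‖A i - A j‖ ≤ ε
  norm_input_sub_le : ∀ i, ‖B i - B j‖ ≤ ε
  norm_gain_sub_le : ∀ i, ‖K i - K j‖ ≤ ε

/-- The switched system with input delay `D` whose input is, at every time, some convex combination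
of the predictor feedbacks of the modes. -/
structure IsPredictorLoop (D : ℝ) (A : ι → E →L[ℝ] E) (B : ι → F →L[ℝ] E) (K : ι → E →L[ℝ] F)
    (σ : ℝ → ι) (x : ℝ → E) (U : ℝ → F) : Prop where
  input : IsAdmissibleInput D U
  dynamics : HasIntegralDeriv x fun t => A (σ t) (x t) + B (σ t) (U (t - D))
  feedback : ∀ t, 0 ≤ t →
    U t ∈ convexHull ℝ (Set.range fun i => K i (opPredictor D (A i) (B i) x U t))

variable {D M ε t : ℝ} {A : ι → E →L[ℝ] E} {B : ι → F →L[ℝ] E} {K : ι → E →L[ℝ] F} {j : ι}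
  {σ : ℝ → ι} {x : ℝ → E} {U : ℝ → F}

/-- The derivative of the predictor of mode `j` along the switched system. -/
noncomputable def targetDeriv (D : ℝ) (A : ι → E →L[ℝ] E) (B : ι → F →L[ℝ] E) (j : ι) (σ : ℝ → ι)
    (x : ℝ → E) (U : ℝ → F) (t : ℝ) : E :=
  A j (opPredictor D (A j) (B j) x U t) + B j (U t) + NormedSpace.exp (D • A j)
    ((A (σ t) - A j) (x t) + (B (σ t) - B j) (U (t - D)))

variable [CompleteSpace E]

theorem IsModeCluster.norm_gain_opPredictor_sub_le (h : IsModeCluster A B K j M ε) (hD : 0 ≤ D)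
    (hU : MemLp U 2 (volume.restrict (Set.Ioc (t - D) t))) (i : ι) :
    ‖K i (opPredictor D (A i) (B i) x U t) - K j (opPredictor D (A j) (B j) x U t)‖
      ≤ ε * (M * predictorBound D M ^ 2 + 1)
        * (‖opPredictor D (A j) (B j) x U t‖ + inputNorm D U t) := by
  have hM : 0 ≤ M := (norm_nonneg _).trans (h.norm_state_le j)
  have hε : 0 ≤ ε := (norm_nonneg _).trans (h.norm_state_sub_le j)
  have hC := one_le_predictorBound hD hM
  have hdiff := norm_opPredictor_sub_le_predictorBound (x := x) hD (h.norm_state_le i)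
    (h.norm_input_le i) (h.norm_state_le j) (h.norm_state_sub_le i) (h.norm_input_sub_le i) hU
  have hinv := norm_add_inputNorm_le (x := x) hD (h.norm_state_le j) (h.norm_input_le j) hU
  set C := predictorBound D M
  set pᵢ := opPredictor D (A i) (B i) x U t
  set p := opPredictor D (A j) (B j) x U t
  calc ‖K i pᵢ - K j p‖ = ‖K i (pᵢ - p) + (K i - K j) p‖ := by
        rw [map_sub, sub_apply, sub_add_sub_cancel]
    _ ≤ M * ‖pᵢ - p‖ + ε * ‖p‖ := (norm_add_le _ _).trans (add_le_add
        ((K i).le_of_opNorm_le (h.norm_gain_le i) _)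
        ((K i - K j).le_of_opNorm_le (h.norm_gain_sub_le i) _))
    _ ≤ M * (C * ε * (C * (‖p‖ + inputNorm D U t))) + ε * (‖p‖ + inputNorm D U t) := by
        gcongr
        · exact hdiff.trans (by gcongr)
        · exact le_add_of_nonneg_right (inputNorm_nonneg D U t)
    _ = _ := by ring

theorem IsModeCluster.norm_drift_le (h : IsModeCluster A B K j M ε) (hD : 0 ≤ D)
    (hU : MemLp U 2 (volume.restrict (Set.Ioc (t - D) t))) (i : ι) (w : F) :
    ‖(A i - A j) (x t) + (B i - B j) w‖ ≤ ε * (predictorBound D M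
      * (‖opPredictor D (A j) (B j) x U t‖ + inputNorm D U t + ‖w‖)) := by
  have hM : 0 ≤ M := (norm_nonneg _).trans (h.norm_state_le j)
  have hε : 0 ≤ ε := (norm_nonneg _).trans (h.norm_state_sub_le j)
  have hinv := norm_add_inputNorm_le (x := x) hD (h.norm_state_le j) (h.norm_input_le j) hU
  have hw := le_mul_of_one_le_left (norm_nonneg w) (one_le_predictorBound hD hM)
  calc _ ≤ ε * ‖x t‖ + ε * ‖w‖ := (norm_add_le _ _).trans (add_le_add
        ((A i - A j).le_of_opNorm_le (h.norm_state_sub_le i) _)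
        ((B i - B j).le_of_opNorm_le (h.norm_input_sub_le i) w))
    _ = ε * (‖x t‖ + ‖w‖) := (mul_add _ _ _).symm
    _ ≤ _ := by
        gcongr
        linarith [inputNorm_nonneg D U t]

namespace IsPredictorLoop

theorem norm_input_sub_gain_le (h : IsPredictorLoop D A B K σ x U)
    (hmodes : IsModeCluster A B K j M ε) (hD : 0 ≤ D) (ht : 0 ≤ t) :
    ‖U t - K j (opPredictor D (A j) (B j) x U t)‖
      ≤ ε * (M * predictorBound D M ^ 2 + 1)
        * (‖opPredictor D (A j) (B j) x U t‖ + inputNorm D U t) := by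
  rw [← mem_closedBall_iff_norm]
  refine convexHull_min (Set.range_subset_iff.2 fun i => ?_) (convex_closedBall _ _)
    (h.feedback t ht)
  rw [mem_closedBall_iff_norm]
  exact hmodes.norm_gain_opPredictor_sub_le hD (h.input.memLp_window ht) i

theorem hasIntegralDeriv_opPredictor (h : IsPredictorLoop D A B K σ x U) (hD : 0 ≤ D) (j : ι) :
    HasIntegralDeriv (opPredictor D (A j) (B j) x U) (targetDeriv D A B j σ x U) := by
  refine HasIntegralDeriv.opPredictor hD h.input (h.dynamics.congr (fun _ _ => rfl) fun t _ => ?_)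
  simp only [sub_apply]
  abel

end IsPredictorLoop

/-- The factor by which the distance between the modes is amplified in the target system of a
predictor loop. -/
noncomputable def mismatchGain (D M : ℝ) : ℝ :=
  (M + 1) * (M * predictorBound D M ^ 2 + 1) + Real.exp (D * M) * predictorBound D M

theorem mismatchGain_pos (hD : 0 ≤ D) (hM : 0 ≤ M) : 0 < mismatchGain D M := by
  have hC := one_le_predictorBound hD hM
  unfold mismatchGain
  positivity

namespace IsPredictorLoop

theorem norm_target_drift_le (h : IsPredictorLoop D A B K σ x U)
    (hmodes : IsModeCluster A B K j M ε) (hD : 0 ≤ D) (ht : 0 ≤ t) :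
    ‖targetDeriv D A B j σ x U t - (A j + B j ∘L K j) (opPredictor D (A j) (B j) x U t)‖
      ≤ ε * mismatchGain D M
        * (‖opPredictor D (A j) (B j) x U t‖ + inputNorm D U t + ‖U (t - D)‖) := by
  have hM : 0 ≤ M := (norm_nonneg _).trans (hmodes.norm_state_le j)
  have hε : 0 ≤ ε := (norm_nonneg _).trans (hmodes.norm_state_sub_le j)
  have hinput := h.norm_input_sub_gain_le hmodes hD ht
  have hd := hmodes.norm_drift_le (x := x) hD (h.input.memLp_window ht) (σ t) (U (t - D))
  have hC := one_le_predictorBound hD hM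
  have hu := inputNorm_nonneg D U t
  unfold mismatchGain targetDeriv
  set C := predictorBound D M
  set p := opPredictor D (A j) (B j) x U t
  set d := (A (σ t) - A j) (x t) + (B (σ t) - B j) (U (t - D))
  set u := inputNorm D U t
  set v := ‖U (t - D)‖
  calc ‖A j p + B j (U t) + NormedSpace.exp (D • A j) d - (A j + B j ∘L K j) p‖
      = ‖B j (U t - K j p) + NormedSpace.exp (D • A j) d‖ := by
        rw [add_apply, ContinuousLinearMap.comp_apply, map_sub]
        congr 1
        abel
    _ ≤ M * (ε * (M * C ^ 2 + 1) * (‖p‖ + u)) + Real.exp (D * M) * (ε * (C * (‖p‖ + u + v))) :=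
        (norm_add_le _ _).trans (add_le_add
          (((B j).le_of_opNorm_le (hmodes.norm_input_le j) _).trans (by gcongr))
          ((ContinuousLinearMap.le_of_opNorm_le _
            (norm_exp_smul_le (hmodes.norm_state_le j) (abs_of_nonneg hD).le) d).trans (by gcongr)))
    _ ≤ (M + 1) * (ε * (M * C ^ 2 + 1) * (‖p‖ + u + v))
          + Real.exp (D * M) * (ε * (C * (‖p‖ + u + v))) := by
        have hv : ‖p‖ + u ≤ ‖p‖ + u + v := le_add_of_nonneg_right (norm_nonneg _)
        gcongr
        exact le_add_of_nonneg_right zero_le_one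
    _ = _ := by ring

theorem norm_input_le (h : IsPredictorLoop D A B K σ x U)
    (hmodes : IsModeCluster A B K j M ε) (hD : 0 ≤ D) (hε : ε * mismatchGain D M ≤ 1)
    (ht : 0 ≤ t) :
    ‖U t‖ ≤ (M + 1) * ‖opPredictor D (A j) (B j) x U t‖
      + ε * mismatchGain D M * inputNorm D U t := by
  have hM : 0 ≤ M := (norm_nonneg _).trans (hmodes.norm_state_le j)
  have hε₀ : 0 ≤ ε := (norm_nonneg _).trans (hmodes.norm_state_sub_le j)
  have hC := one_le_predictorBound hD hM
  have hu := inputNorm_nonneg D U t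
  set p := opPredictor D (A j) (B j) x U t
  have hgain : M * predictorBound D M ^ 2 + 1 ≤ mismatchGain D M := by
    have : 0 ≤ M * (M * predictorBound D M ^ 2 + 1)
      + Real.exp (D * M) * predictorBound D M := by positivity
    unfold mismatchGain
    linarith
  calc ‖U t‖ ≤ ‖K j p‖ + ‖U t - K j p‖ := norm_le_norm_add_norm_sub' _ _
    _ ≤ M * ‖p‖ + ε * mismatchGain D M * (‖p‖ + inputNorm D U t) :=
        add_le_add ((K j).le_of_opNorm_le (hmodes.norm_gain_le j) p)
          ((h.norm_input_sub_gain_le hmodes hD ht).trans (by gcongr))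
    _ ≤ _ := by linarith [mul_le_mul_of_nonneg_right hε (norm_nonneg p)]

end IsPredictorLoop

end NormedSpace

variable [InnerProductSpace ℝ E] [CompleteSpace E]

namespace IsPredictorLoop

theorem isPerturbedTarget {D M ε : ℝ} {A : ι → E →L[ℝ] E} {B : ι → F →L[ℝ] E}
    {K : ι → E →L[ℝ] F} {j : ι} {σ : ℝ → ι} {x : ℝ → E} {U : ℝ → F}
    (h : IsPredictorLoop D A B K σ x U) (hmodes : IsModeCluster A B K j M ε) (hD : 0 ≤ D)
    (hε : ε * mismatchGain D M ≤ 1) :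
    IsPerturbedTarget D (A j + B j ∘L K j) (M + 1) (ε * mismatchGain D M)
      (opPredictor D (A j) (B j) x U) (targetDeriv D A B j σ x U) U where
  input := h.input
  hasIntegralDeriv := h.hasIntegralDeriv_opPredictor hD j
  drift _ ht := h.norm_target_drift_le hmodes hD ht
  feedback _ ht := h.norm_input_le hmodes hD hε ht

theorem exists_decay (F : Type*) [NormedAddCommGroup F] [NormedSpace ℝ F] {D M c q : ℝ}
    {P : E →L[ℝ] E} (hD : 0 ≤ D) (hM : 0 ≤ M) (hP : (P : E →ₗ[ℝ] E).IsSymmetric) (hc : 0 < c)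
    (hPc : ∀ y, c * ‖y‖ ^ 2 ≤ ⟪y, P y⟫_ℝ) (hq : 0 < q) :
    ∃ εstar ρ ξ : ℝ, 0 < εstar ∧ 0 < ρ ∧ 0 < ξ ∧
      ∀ {ι : Type*} (A : ι → E →L[ℝ] E) (B : ι → F →L[ℝ] E) (K : ι → E →L[ℝ] F) (j : ι) (ε : ℝ)
        (σ : ℝ → ι) (x : ℝ → E) (U : ℝ → F), IsModeCluster A B K j M ε → ε ≤ εstar →
      (∀ y, 2 * ⟪P y, (A j + B j ∘L K j) y⟫_ℝ ≤ -q * ‖y‖ ^ 2) → IsPredictorLoop D A B K σ x U →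
      ∀ t, 0 ≤ t → ‖x t‖ + inputNorm D U t
        ≤ ρ * (‖x 0‖ + inputNorm D U 0) * Real.exp (-ξ * t) := by
  obtain ⟨ηstar, ρ, ξ, hηstar, hρ, hξ, hdecay⟩ :=
    IsPerturbedTarget.exists_decay F hD hP hc hPc hq (κ := M + 1) (by positivity)
  have hgain := mismatchGain_pos hD hM
  have hC := one_le_predictorBound hD hM
  set C := predictorBound D M
  refine ⟨min 1 ηstar / mismatchGain D M, C * ρ * C, ξ, by positivity, by positivity, hξ,
    fun A B K j ε σ x U hmodes hεstar hdiss h t ht => ?_⟩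
  have hη : ε * mismatchGain D M ≤ min 1 ηstar := (le_div_iff₀ hgain).1 hεstar
  have hε₀ : 0 ≤ ε := (norm_nonneg _).trans (hmodes.norm_state_sub_le j)
  have htarget := h.isPerturbedTarget hmodes hD (hη.trans (min_le_left _ _))
  have hpt := hdecay _ _ _ _ _ (by positivity) (hη.trans (min_le_right _ _)) hdiss htarget t ht
  have hA := hmodes.norm_state_le j
  have hB := hmodes.norm_input_le j
  calc ‖x t‖ + inputNorm D U t
      ≤ C * (‖opPredictor D (A j) (B j) x U t‖ + inputNorm D U t) :=
        norm_add_inputNorm_le hD hA hB (h.input.memLp_window ht)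
    _ ≤ C * (ρ * (C * (‖x 0‖ + inputNorm D U 0)) * Real.exp (-ξ * t)) := by
        gcongr
        refine hpt.trans ?_
        gcongr
        exact norm_opPredictor_add_inputNorm_le hD hA hB (h.input.memLp_window le_rfl)
    _ = _ := by ring

end IsPredictorLoop

end SwitchedLoop

section Switching

variable {l : ℕ} {τ : ℝ} {σ : ℝ → Fin (l + 1)}

theorem IsSwitchingSignal.countable_switchingTimes (hτ : 0 < τ) (hσ : IsSwitchingSignal τ σ) :
    {t | IsSwitchingTime σ t}.Countable := by
  refine Set.MapsTo.countable_of_injOn (f := fun t : ℝ => ⌊t / τ⌋) (Set.mapsTo_univ _ _) ?_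
    Set.countable_univ
  have hnot_lt : ∀ s t, IsSwitchingTime σ s → IsSwitchingTime σ t → ⌊s / τ⌋ = ⌊t / τ⌋ →
      ¬ s < t := fun s t hs ht hst hlt => by
    have hdwell := hσ.dwell s t hs ht hlt
    have hfloor := Int.abs_sub_lt_one_of_floor_eq_floor hst
    rw [← sub_div, abs_lt, lt_div_iff₀ hτ] at hfloor
    linarith [hfloor.1]
  exact fun s hs t ht hst => le_antisymm (not_lt.1 (hnot_lt t s ht hs hst.symm))
    (not_lt.1 (hnot_lt s t hs ht hst))

theorem IsSwitchingSignal.eventually_eq (hσ : IsSwitchingSignal τ σ) {t : ℝ} (ht : 0 < t)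
    (hts : ¬ IsSwitchingTime σ t) : ∀ᶠ s in 𝓝 t, σ s = σ t := by
  rw [← nhdsLT_sup_nhdsGE, ← nhdsGT_sup_nhdsWithin_singleton, eventually_sup, eventually_sup]
  refine ⟨?_, hσ.right_continuous t ht.le, by simp⟩
  by_contra h
  exact hts ⟨ht, h⟩

theorem IsSwitchingSignal.aemeasurable (hσ : IsSwitchingSignal τ σ) (hτ : 0 < τ) :
    AEMeasurable σ (volume.restrict (Set.Ici 0)) := by
  have hcountable := hσ.countable_switchingTimes hτ
  have hae : (Set.Ioi (0 : ℝ) \ {t | IsSwitchingTime σ t} : Set ℝ) =ᵐ[volume] Set.Ici (0 : ℝ) :=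
    (sdiff_null_ae_eq_self (hcountable.measure_zero volume)).trans Ioi_ae_eq_Ici
  rw [← Measure.restrict_congr_set hae]
  refine ContinuousOn.aemeasurable (fun t ht => ?_)
    (measurableSet_Ioi.diff hcountable.measurableSet)
  exact (continuousAt_const.congr ((hσ.eventually_eq ht.1 ht.2).mono
    fun _ h => h.symm)).continuousWithinAt

end Switching

section SwitchedDynamics

variable {E F : Type*} [NormedAddCommGroup E] [NormedSpace ℝ E] [NormedAddCommGroup F]
  [NormedSpace ℝ F]

theorem intervalIntegrable_clm_apply {Φ : ℝ → E →L[ℝ] F} {h : ℝ → E} {M t : ℝ}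
    (hΦ : AEStronglyMeasurable Φ (volume.restrict (Set.Ici 0))) (hM : ∀ s, ‖Φ s‖ ≤ M)
    (hh : IntervalIntegrable h volume 0 t) (ht : 0 ≤ t) :
    IntervalIntegrable (fun s => Φ s (h s)) volume 0 t := by
  rw [intervalIntegrable_iff_integrableOn_Ioc_of_le ht] at hh ⊢
  exact (ContinuousLinearMap.id ℝ (E →L[ℝ] F)).integrable_of_bilin_of_bdd_left M
    (hΦ.mono_measure (Measure.restrict_mono (fun s hs => hs.1.le) le_rfl)) (ae_of_all _ hM) hh

theorem hasIntegralDeriv_switched {ι : Type*} [Finite ι] [MeasurableSpace ι]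
    [DiscreteMeasurableSpace ι] {D : ℝ} {A : ι → E →L[ℝ] E} {B : ι → F →L[ℝ] E} {σ : ℝ → ι}
    {x : ℝ → E} {U : ℝ → F} (hD : 0 ≤ D) (hσ : AEMeasurable σ (volume.restrict (Set.Ici 0)))
    (hx : ContinuousOn x (Set.Ici 0)) (hU : IsAdmissibleInput D U)
    (hdynamics : ∀ t, 0 ≤ t →
      x t = x 0 + ∫ s in (0 : ℝ)..t, (A (σ s) (x s) + B (σ s) (U (s - D)))) :
    HasIntegralDeriv x fun t => A (σ t) (x t) + B (σ t) (U (t - D)) := by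
  refine ⟨fun t ht => ?_, hdynamics⟩
  have hA : AEStronglyMeasurable (fun t => A (σ t)) (volume.restrict (Set.Ici 0)) :=
    StronglyMeasurable.of_discrete.aestronglyMeasurable.comp_aemeasurable hσ
  have hB : AEStronglyMeasurable (fun t => B (σ t)) (volume.restrict (Set.Ici 0)) :=
    StronglyMeasurable.of_discrete.aestronglyMeasurable.comp_aemeasurable hσ
  obtain ⟨MA, hMA⟩ := Finite.exists_le fun i => ‖A i‖
  obtain ⟨MB, hMB⟩ := Finite.exists_le fun i => ‖B i‖
  have hxt : IntervalIntegrable x volume 0 t := (hx.mono (by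
    rw [Set.uIcc_of_le ht]
    exact Set.Icc_subset_Ici_self)).intervalIntegrable
  have hUt : IntervalIntegrable (fun s => U (s - D)) volume 0 t :=
    intervalIntegrable_delayed (fun _ => hU.intervalIntegrable hD) ht
  exact (intervalIntegrable_clm_apply hA (fun s => hMA (σ s)) hxt ht).add
    (intervalIntegrable_clm_apply hB (fun s => hMB (σ s)) hUt ht)

end SwitchedDynamics

theorem toLp_intervalIntegral {n : Type*} [Fintype n] (f : ℝ → n → ℝ) (a b : ℝ) :
    WithLp.toLp 2 (∫ s in a..b, f s) = ∫ s in a..b, WithLp.toLp 2 (f s) := by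
  have hcomm (μ : Measure ℝ) :=
    (PiLp.continuousLinearEquiv 2 ℝ (fun _ : n => ℝ)).symm.integral_comp_comm (μ := μ) f
  rw [intervalIntegral, intervalIntegral, WithLp.toLp_sub]
  exact congrArg₂ (· - ·) (hcomm _).symm (hcomm _).symm

section EuclideanOperators

open Matrix
open scoped InnerProductSpace

variable {m n : Type*} [Fintype m] [Fintype n] [DecidableEq n]

/-- A real matrix as a continuous linear map between Euclidean spaces. -/
noncomputable def euclideanOp :
    Matrix m n ℝ ≃ₗ[ℝ] EuclideanSpace ℝ n →L[ℝ] EuclideanSpace ℝ m :=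
  toEuclideanLin ≪≫ₗ LinearMap.toContinuousLinearMap

theorem norm_euclideanOp (A : Matrix m n ℝ) : ‖euclideanOp A‖ = ‖A‖ := (l2_opNorm_def A).symm

theorem euclideanOp_toLp (A : Matrix m n ℝ) (x : n → ℝ) :
    euclideanOp A (WithLp.toLp 2 x) = WithLp.toLp 2 (A *ᵥ x) := rfl

theorem euclideanOp_mul [DecidableEq m] {k : Type*} [Fintype k] (A : Matrix k m ℝ)
    (B : Matrix m n ℝ) : euclideanOp (A * B) = euclideanOp A ∘L euclideanOp B := by
  ext1 x
  exact congrArg (WithLp.toLp 2) (mulVec_mulVec x.ofLp A B).symm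

theorem euclideanOp_exp (A : Matrix n n ℝ) :
    euclideanOp (NormedSpace.exp A) = NormedSpace.exp (euclideanOp A) := by
  let _ : NormedAlgebra ℚ (Matrix n n ℝ) := .restrictScalars ℚ ℝ _
  exact NormedSpace.map_exp (toEuclideanCLM (n := n) (𝕜 := ℝ))
    (AddMonoidHomClass.isometry_of_norm _ fun A => l2_opNorm_toEuclideanCLM A).continuous A

theorem isSymmetric_euclideanOp {P : Matrix n n ℝ} (hP : P.IsHermitian) :
    (euclideanOp P : EuclideanSpace ℝ n →ₗ[ℝ] EuclideanSpace ℝ n).IsSymmetric :=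
  isSymmetric_toEuclideanLin_iff.2 hP

theorem inner_euclideanOp_transpose (A : Matrix n n ℝ) (x y : EuclideanSpace ℝ n) :
    ⟪x, euclideanOp Aᵀ y⟫_ℝ = ⟪euclideanOp A x, y⟫_ℝ := by
  rw [← conjTranspose_eq_transpose_of_trivial]
  have hadjoint : euclideanOp Aᴴ y = LinearMap.adjoint (toEuclideanLin A) y :=
    LinearMap.congr_fun (toEuclideanLin_conjTranspose_eq_adjoint A) y
  rw [hadjoint]
  exact LinearMap.adjoint_inner_right (toEuclideanLin A) x y

theorem inner_euclideanOp_nonneg {S : Matrix n n ℝ} (hS : S.PosSemidef) (y : EuclideanSpace ℝ n) :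
    0 ≤ ⟪y, euclideanOp S y⟫_ℝ :=
  (isPositive_toEuclideanLin_iff.2 hS).inner_nonneg_right y

theorem exists_mul_sq_le_inner {E : Type*} [NormedAddCommGroup E] [InnerProductSpace ℝ E]
    [FiniteDimensional ℝ E] {P : E →L[ℝ] E} (hP : ∀ x, x ≠ 0 → 0 < ⟪x, P x⟫_ℝ) :
    ∃ c : ℝ, 0 < c ∧ ∀ x, c * ‖x‖ ^ 2 ≤ ⟪x, P x⟫_ℝ := by
  have hcont : Continuous fun x => ⟪x, P x⟫_ℝ := continuous_id.inner P.continuous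
  obtain ⟨c, hc, hsphere⟩ := (isCompact_sphere (0 : E) 1).exists_forall_le' hcont.continuousOn
    (a := 0) fun x hx => hP x (ne_zero_of_mem_unit_sphere ⟨x, hx⟩)
  refine ⟨c, hc, fun x => ?_⟩
  rcases eq_or_ne x 0 with rfl | hx
  · simp
  have hunit := hsphere (‖x‖⁻¹ • x) (by simp [norm_smul, norm_ne_zero_iff.2 hx])
  rw [map_smul, inner_smul_left, inner_smul_right, RCLike.conj_to_real, ← mul_assoc] at hunit
  calc c * ‖x‖ ^ 2 ≤ ‖x‖⁻¹ * ‖x‖⁻¹ * ⟪x, P x⟫_ℝ * ‖x‖ ^ 2 := by gcongr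
    _ = _ := by field_simp

theorem exists_mul_sq_le_inner_of_posDef {P : Matrix n n ℝ} (hP : P.PosDef) :
    ∃ c : ℝ, 0 < c ∧ ∀ x, c * ‖x‖ ^ 2 ≤ ⟪x, euclideanOp P x⟫_ℝ :=
  exists_mul_sq_le_inner fun x hx => by
    have hpos := hP.dotProduct_mulVec_pos (x := x.ofLp) (by simpa using hx)
    exact (inner_toEuclideanCLM P x x).symm ▸ by simpa using hpos

theorem two_inner_le_of_posSemidef {P Q H : Matrix n n ℝ} (hP : P.IsHermitian)
    (h : (-Q - (Hᵀ * P + P * H)).PosSemidef) (y : EuclideanSpace ℝ n) :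
    2 * ⟪euclideanOp P y, euclideanOp H y⟫_ℝ ≤ -⟪y, euclideanOp Q y⟫_ℝ := by
  have hsymm : ⟪euclideanOp P y, euclideanOp H y⟫_ℝ = ⟪y, euclideanOp P (euclideanOp H y)⟫_ℝ :=
    isSymmetric_euclideanOp hP _ _
  have hnonneg := inner_euclideanOp_nonneg h y
  rw [map_sub, map_neg, map_add, euclideanOp_mul, euclideanOp_mul, _root_.sub_apply,
    _root_.neg_apply, _root_.add_apply, ContinuousLinearMap.comp_apply,
    ContinuousLinearMap.comp_apply, inner_sub_right, inner_neg_right, inner_add_right,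
    inner_euclideanOp_transpose, ← hsymm, real_inner_comm (euclideanOp P y)] at hnonneg
  linarith

end EuclideanOperators

section ClosedLoop

open Matrix

variable {n l : ℕ} {D : ℝ} {A : Fin (l + 1) → Matrix (Fin n) (Fin n) ℝ}
  {B : Fin (l + 1) → Matrix (Fin n) (Fin 1) ℝ} {K : Fin (l + 1) → Matrix (Fin 1) (Fin n) ℝ}
  {X : ℝ → Fin n → ℝ} {U : ℝ → ℝ}

/-- A vector-valued signal as a signal in Euclidean space. -/
noncomputable def euclideanSignal {m : ℕ} (X : ℝ → Fin m → ℝ) (t : ℝ) :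
    EuclideanSpace ℝ (Fin m) :=
  WithLp.toLp 2 (X t)

theorem norm_toLp_singleton (r : ℝ) :
    ‖(WithLp.toLp 2 ![r] : EuclideanSpace ℝ (Fin 1))‖ = |r| := by
  simp [EuclideanSpace.norm_eq, Real.sqrt_sq_eq_abs]

theorem stateNorm_eq (D : ℝ) (X : ℝ → Fin n → ℝ) (U : ℝ → ℝ) (t : ℝ) :
    stateNorm D X U t
      = ‖euclideanSignal X t‖ + inputNorm D (euclideanSignal fun s => ![U s]) t := by
  simp only [stateNorm, inputNorm, euclideanSignal, norm_toLp_singleton, sq_abs]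

theorem toLp_predictor (D : ℝ) (A : Matrix (Fin n) (Fin n) ℝ) (B : Matrix (Fin n) (Fin 1) ℝ)
    (X : ℝ → Fin n → ℝ) (U : ℝ → ℝ) (t : ℝ) :
    WithLp.toLp 2 (predictor D A B X U t) = opPredictor D (euclideanOp A) (euclideanOp B)
      (euclideanSignal X) (euclideanSignal fun s => ![U s]) t := by
  simp only [predictor, opPredictor, windowDuhamel, euclideanSignal, WithLp.toLp_add,
    toLp_intervalIntegral, ← euclideanOp_toLp, euclideanOp_exp, map_smul]

theorem toLp_averagedFeedback_mem_convexHull (D : ℝ) (A : Fin (l + 1) → Matrix (Fin n) (Fin n) ℝ)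
    (B : Fin (l + 1) → Matrix (Fin n) (Fin 1) ℝ) (K : Fin (l + 1) → Matrix (Fin 1) (Fin n) ℝ)
    (X : ℝ → Fin n → ℝ) (U : ℝ → ℝ) (t : ℝ) :
    WithLp.toLp 2 ![averagedFeedback D A B K X U t] ∈ convexHull ℝ (Set.range fun i =>
      euclideanOp (K i) (opPredictor D (euclideanOp (A i)) (euclideanOp (B i))
        (euclideanSignal X) (euclideanSignal fun s => ![U s]) t)) := by
  refine mem_convexHull_of_exists_fintype (ι := Fin (l + 1)) (fun _ => ((l : ℝ) + 1)⁻¹) _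
    (fun _ => by positivity) ?_ (fun i => Set.mem_range_self i) ?_
  · rw [Finset.sum_const, Finset.card_univ, Fintype.card_fin, nsmul_eq_mul, Nat.cast_succ]
    exact mul_inv_cancel₀ (by positivity)
  · ext i
    fin_cases i
    simp [averagedFeedback, ← toLp_predictor, euclideanOp_toLp, div_eq_inv_mul]

theorem IsClosedLoopSolution.isPredictorLoop {σ : ℝ → Fin (l + 1)} {X₀ : Fin n → ℝ} {U₀ : ℝ → ℝ}
    (h : IsClosedLoopSolution D A B K σ X₀ U₀ X U) (hD : 0 ≤ D)
    (hσ : AEMeasurable σ (volume.restrict (Set.Ici 0))) :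
    IsPredictorLoop D (fun i => euclideanOp (A i)) (fun i => euclideanOp (B i))
      (fun i => euclideanOp (K i)) σ (euclideanSignal X) (euclideanSignal fun s => ![U s]) := by
  have hU : IsAdmissibleInput D (euclideanSignal fun s => ![U s]) := fun t ht =>
    MemLp.of_eval_piLp (Fin.forall_fin_one.2 (h.input_memLp t ht))
  refine ⟨hU, hasIntegralDeriv_switched (x := euclideanSignal X) (A := fun i => euclideanOp (A i))
    (B := fun i => euclideanOp (B i)) hD hσ
    ((PiLp.continuous_toLp 2 _).comp_continuousOn h.state_continuous) hU fun t ht => ?_,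
    fun t ht => ?_⟩
  · simp only [euclideanSignal, euclideanOp_toLp, ← WithLp.toLp_add, ← toLp_intervalIntegral,
      ← h.dynamics t ht]
  · rw [euclideanSignal, h.feedback t ht]
    exact toLp_averagedFeedback_mem_convexHull D A B K X U t

theorem IsClosedLoopSolution.stateNorm_zero {σ : ℝ → Fin (l + 1)} {X₀ : Fin n → ℝ} {U₀ : ℝ → ℝ}
    (h : IsClosedLoopSolution D A B K σ X₀ U₀ X U) (hD : 0 ≤ D) :
    stateNorm D X U 0 = ‖WithLp.toLp 2 X₀‖ + √(∫ θ in (-D)..0, U₀ θ ^ 2) := by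
  have hinput : ∫ θ in (-D)..0, U θ ^ 2 = ∫ θ in (-D)..0, U₀ θ ^ 2 := by
    have hle : -D ≤ 0 := by linarith
    rw [intervalIntegral.integral_of_le hle, intervalIntegral.integral_of_le hle,
      ← integral_Ico_eq_integral_Ioc, ← integral_Ico_eq_integral_Ioc]
    exact integral_congr_ae (h.initial_input.mono fun θ hθ => congrArg (· ^ 2) hθ)
  rw [stateNorm, h.initial_state, zero_sub, hinput]

theorem max_norm_sub_le_mismatch (A : Fin (l + 1) → Matrix (Fin n) (Fin n) ℝ)
    (B : Fin (l + 1) → Matrix (Fin n) (Fin 1) ℝ) (K : Fin (l + 1) → Matrix (Fin 1) (Fin n) ℝ)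
    (i j : Fin (l + 1)) :
    max ‖A i - A j‖ (max ‖B i - B j‖ ‖K i - K j‖) ≤ mismatch A B K :=
  le_ciSup (f := fun p : Fin (l + 1) × Fin (l + 1) =>
    max ‖A p.1 - A p.2‖ (max ‖B p.1 - B p.2‖ ‖K p.1 - K p.2‖)) (Set.finite_range _).bddAbove (i, j)

theorem isModeCluster_euclideanOp {M : ℝ} (hA : ∀ i, ‖A i‖ ≤ M) (hB : ∀ i, ‖B i‖ ≤ M)
    (hK : ∀ i, ‖K i‖ ≤ M) (j : Fin (l + 1)) :
    IsModeCluster (fun i => euclideanOp (A i)) (fun i => euclideanOp (B i))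
      (fun i => euclideanOp (K i)) j M (mismatch A B K) := by
  have hsub (i : Fin (l + 1)) := max_norm_sub_le_mismatch A B K i j
  simp only [max_le_iff] at hsub
  constructor <;> intro i <;> simp only [← map_sub, norm_euclideanOp]
  exacts [hA i, hB i, hK i, (hsub i).1, (hsub i).2.1, (hsub i).2.2]

end ClosedLoop

end SwitchedDelay

open SwitchedDelay

theorem theorem2p1_general (n : ℕ) (D : ℝ) (hD : 0 ≤ D)
    (P Q : Matrix (Fin n) (Fin n) ℝ) (hP : P.PosDef) (hQ : Q.PosDef) (MA MB MK : ℝ) :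
    ∃ εstar ρ ξ : ℝ, 0 < εstar ∧ 0 < ρ ∧ 0 < ξ ∧
      ∀ (l : ℕ) (A : Fin (l + 1) → Matrix (Fin n) (Fin n) ℝ)
        (B : Fin (l + 1) → Matrix (Fin n) (Fin 1) ℝ)
        (K : Fin (l + 1) → Matrix (Fin 1) (Fin n) ℝ) (j : Fin (l + 1)),
        (∀ i, ‖A i‖ ≤ MA) → (∀ i, ‖B i‖ ≤ MB) → (∀ i, ‖K i‖ ≤ MK) →
        (-Q - ((A j + B j * K j)ᵀ * P + P * (A j + B j * K j))).PosSemidef →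
        mismatch A B K < εstar →
        ∀ σ : ℝ → Fin (l + 1), AEMeasurable σ (volume.restrict (Set.Ici 0)) →
        ∀ (X₀ : Fin n → ℝ) (U₀ : ℝ → ℝ) (X : ℝ → Fin n → ℝ) (U : ℝ → ℝ),
          IsClosedLoopSolution D A B K σ X₀ U₀ X U →
          ∀ t : ℝ, 0 ≤ t → stateNorm D X U t
            ≤ ρ * (‖WithLp.toLp 2 X₀‖ + √(∫ θ in (-D)..0, U₀ θ ^ 2)) * Real.exp (-ξ * t) := by
  obtain ⟨c, hc, hPc⟩ := exists_mul_sq_le_inner_of_posDef hP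
  obtain ⟨q, hq, hQq⟩ := exists_mul_sq_le_inner_of_posDef hQ
  let M : ℝ := max 0 (max MA (max MB MK))
  obtain ⟨εstar, ρ, ξ, hεstar, hρ, hξ, hdecay⟩ := IsPredictorLoop.exists_decay
    (EuclideanSpace ℝ (Fin 1)) hD (le_max_left 0 _ : 0 ≤ M) (isSymmetric_euclideanOp hP.1) hc
    hPc hq
  refine ⟨εstar, ρ, ξ, hεstar, hρ, hξ, ?_⟩
  intro l A B K j hA hB hK hlyap hmis σ hσ X₀ U₀ X U hsol t ht
  have hmodes := isModeCluster_euclideanOp (M := M) (A := A) (B := B) (K := K)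
    (fun i => (hA i).trans (by simp [M])) (fun i => (hB i).trans (by simp [M]))
    (fun i => (hK i).trans (by simp [M])) j
  have hdiss (y) : 2 * inner ℝ (euclideanOp P y)
      ((euclideanOp (A j) + euclideanOp (B j) ∘L euclideanOp (K j)) y) ≤ -q * ‖y‖ ^ 2 := by
    rw [← euclideanOp_mul, ← map_add, neg_mul]
    exact (two_inner_le_of_posSemidef hP.1 hlyap y).trans (neg_le_neg (hQq y))
  rw [← hsol.stateNorm_zero hD, stateNorm_eq, stateNorm_eq]
  exact hdecay _ _ _ j _ σ _ _ hmodes hmis.le hdiss (hsol.isPredictorLoop hD hσ) t ht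

theorem theorem2p1 (n : ℕ) (D τ : ℝ) (hD : 0 < D) (hτ : 0 < τ)
    (P Q : Matrix (Fin n) (Fin n) ℝ) (hP : P.PosDef) (hQ : Q.PosDef) (MA MB MK : ℝ) :
    ∃ εstar : ℝ, 0 < εstar ∧
      ∀ (l : ℕ) (A : Fin (l + 1) → Matrix (Fin n) (Fin n) ℝ)
        (B : Fin (l + 1) → Matrix (Fin n) (Fin 1) ℝ)
        (K : Fin (l + 1) → Matrix (Fin 1) (Fin n) ℝ),
        (∀ i, ‖A i‖ ≤ MA) → (∀ i, ‖B i‖ ≤ MB) → (∀ i, ‖K i‖ ≤ MK) →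
        (∀ i, (-Q - ((A i + B i * K i)ᵀ * P + P * (A i + B i * K i))).PosSemidef) →
        SwitchedDelay.mismatch A B K < εstar →
        ∃ ρ ξ : ℝ, 0 < ρ ∧ 0 < ξ ∧
          ∀ σ : ℝ → Fin (l + 1), SwitchedDelay.IsSwitchingSignal τ σ →
          ∀ (X₀ : Fin n → ℝ) (U₀ : ℝ → ℝ), MemLp U₀ 2 (volume.restrict (Set.Ico (-D) 0)) →
          ∀ (X : ℝ → Fin n → ℝ) (U : ℝ → ℝ),
            SwitchedDelay.IsClosedLoopSolution D A B K σ X₀ U₀ X U →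
            ∀ t : ℝ, 0 ≤ t →
              SwitchedDelay.stateNorm D X U t
                ≤ ρ * (‖WithLp.toLp 2 X₀‖ + √(∫ θ in (-D)..0, U₀ θ ^ 2)) * Real.exp (-ξ * t) := by
  obtain ⟨εstar, ρ, ξ, hεstar, hρ, hξ, h⟩ := theorem2p1_general n D hD.le P Q hP hQ MA MB MK
  exact ⟨εstar, hεstar, fun l A B K hA hB hK hlyap hmis => ⟨ρ, ξ, hρ, hξ, fun σ hσ X₀ U₀ _ X U =>
    h l A B K 0 hA hB hK (hlyap 0) hmis σ (hσ.aemeasurable hτ) X₀ U₀ X U⟩⟩
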